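/- For $q\ge 1$ let $f(s)=e^{e^{s^q}}$ $(s\ge 0)$ and $F(s)=\int_s^\infty \frac{d\tau}{f(\tau)}$. For a function $h>0$ with $H(s)=\int_s^\infty\frac{d\tau}{h(\tau)}<\infty$ for large $s$, put $$\frac1{B_1[h]}=(-\log H)\,(1-h'H),\qquad \frac1{B_2[h]}=h'H\,(-\log H)^2\Big[\frac{h\,h''H}{h'}-1\Big],$$ and call $B=\lim_{s\to\infty}B_2[h](s)$ the growth exponent of $h$. For growth exponent $B=1$ the model nonlinearity is $g(s)=4e^{e^s}/e^{2s}$, with $G(s)=\int_s^\infty \frac{d\tau}{g(\tau)}$ and $v(x)=\log\log\frac1{|x|^2}$, $x\in\mathbb R^2$. Let $\tilde u(x)=F^{-1}(G(v(x)))$ for small $x\ne0$, and $$R_i(x)=\Big|\frac1{B_i[f](\tilde u(x))}-\frac1{B_i[g](v(x))}\Big|,\qquad i=1,2.$$ The discrepancy condition for $f$ is $$\lim_{x\to0}(-\log|x|)^{1/2}\,[R_1(x)+R_2(x)]=0.$$ Then: 1. For every $q\ge1$, $F(s)<\infty$ for all large $s$, and $f$ has growth exponent $B=1$. 2. The discrepancy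 condition holds for $q=1$ and fails for every $q>1$. 3. For $q=1$ there exist $R>0$ and a nonnegative radial function $u\in C^\infty(B_R(0)\setminus\{0\})$ on the punctured disc in $\mathbb R^2$ with $-\Delta u=f(u)$ in $B_R(0)\setminus\{0\}$, $u(x)\to\infty$ as $x\to0$, and $$u(x)=\log\big[-\log w-\log(-\log w)\big]+O\Big(\frac{\log(-\log w)}{(-\log w)^2}\Big)\quad (x\to0),\qquad w=\tfrac14|x|^2\Big(\log\frac1{|x|^2}+1\Big).$$ -/

import Mathlib

open Real Set Filter Topology Asymptotics
open scoped ContDiff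

noncomputable section

namespace SingularSol

/-- The Euclidean plane. -/
abbrev Plane : Type := EuclideanSpace ℝ (Fin 2)

/-- The nonlinearity `f(s) = exp (exp (s ^ q))`, used for `s ≥ 0`. -/
def doubleExp (q : ℝ) (s : ℝ) : ℝ := exp (exp (s ^ q))

/-- `F(s) = ∫_s^∞ dτ / f(τ)`. -/
def tailIntegral (f : ℝ → ℝ) (s : ℝ) : ℝ := ∫ τ in Ioi s, 1 / f τ

/-- The inverse of `F : (0, ∞) → ℝ` (meaningful on the range of `F`). -/
def tailInverse (f : ℝ → ℝ) (w : ℝ) : ℝ :=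
  Function.invFunOn (tailIntegral f) (Ioi 0) w

/-- `1 / B₁[f](s) = (-log F(s)) (1 - f'(s) F(s))`. -/
def invB₁ (f : ℝ → ℝ) (s : ℝ) : ℝ :=
  (-log (tailIntegral f s)) * (1 - deriv f s * tailIntegral f s)

/-- `1 / B₂[f](s) = f'(s) F(s) (-log F(s))² (f(s) f''(s) F(s) / f'(s) - 1)`. -/
def invB₂ (f : ℝ → ℝ) (s : ℝ) : ℝ :=
  deriv f s * tailIntegral f s * (-log (tailIntegral f s)) ^ 2 *
    (f s * deriv (deriv f) s * tailIntegral f s / deriv f s - 1)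

/-- `B₂[f](s)`. -/
def B₂ (f : ℝ → ℝ) (s : ℝ) : ℝ := 1 / invB₂ f s

/-- The growth exponent of `f` exists and equals `B`: the integral `F(s)` converges for all large
`s`, and `B₂[f](s) → B` as `s → ∞`. -/
def HasGrowthExponent (f : ℝ → ℝ) (B : ℝ) : Prop :=
  (∀ᶠ s in atTop, MeasureTheory.IntegrableOn (fun τ => 1 / f τ) (Ioi s)) ∧
    Tendsto (B₂ f) atTop (𝓝 B)

/-- The explicit solution `v` of the model equation with growth exponent `B ≥ 1`
(`B' = B / (B - 1)` is the conjugate exponent if `B > 1`). -/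
def modelSolution (B : ℝ) (x : Plane) : ℝ :=
  if B = 1 then log (log (1 / ‖x‖ ^ 2)) else (log (1 / ‖x‖ ^ 2)) ^ (1 / B.conjExponent)

/-- The model nonlinearity `g` with growth exponent `B ≥ 1`. -/
def modelNonlinearity (B : ℝ) (s : ℝ) : ℝ :=
  if B = 1 then 4 * exp (exp s) / exp (2 * s)
  else 4 / (B * B.conjExponent) * s ^ (1 - 2 * B.conjExponent) * exp (s ^ B.conjExponent)

/-- The approximate solution `ũ(x) = F⁻¹(G(v(x)))`, where `G(s) = ∫_s^∞ dτ / g(τ)`. -/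
def approxSolution (f : ℝ → ℝ) (B : ℝ) (x : Plane) : ℝ :=
  tailInverse f (tailIntegral (modelNonlinearity B) (modelSolution B x))

/-- `R₁(x) = |1 / B₁[f](ũ(x)) - 1 / B₁[g](v(x))|`. -/
def R₁ (f : ℝ → ℝ) (B : ℝ) (x : Plane) : ℝ :=
  |invB₁ f (approxSolution f B x) - invB₁ (modelNonlinearity B) (modelSolution B x)|

/-- `R₂(x) = |1 / B₂[f](ũ(x)) - 1 / B₂[g](v(x))|`. -/
def R₂ (f : ℝ → ℝ) (B : ℝ) (x : Plane) : ℝ :=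
  |invB₂ f (approxSolution f B x) - invB₂ (modelNonlinearity B) (modelSolution B x)|

/-- The discrepancy condition `(-log |x|)^{1/2} (R₁(x) + R₂(x)) → 0` as `x → 0`, for a
nonlinearity `f` with growth exponent `B`. -/
def DiscrepancyCondition (f : ℝ → ℝ) (B : ℝ) : Prop :=
  Tendsto (fun x : Plane => (-log ‖x‖) ^ (1 / 2 : ℝ) * (R₁ f B x + R₂ f B x))
    (𝓝[≠] 0) (𝓝 0)

/-- `u` is a nonnegative smooth radial singular solution of `-Δ u = f(u)` in the punctured disc of
radius `R`. -/
structure IsSmoothSingularSolution (f : ℝ → ℝ) (R : ℝ) (u : Plane → ℝ) : Prop where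
  contDiffOn : ContDiffOn ℝ ∞ u (Metric.ball 0 R \ {0})
  nonneg : ∀ x ∈ Metric.ball (0 : Plane) R \ {0}, 0 ≤ u x
  radial : ∀ x ∈ Metric.ball (0 : Plane) R \ {0}, ∀ y ∈ Metric.ball (0 : Plane) R \ {0},
    ‖x‖ = ‖y‖ → u x = u y
  equation : ∀ x ∈ Metric.ball (0 : Plane) R \ {0},
    -(Laplacian.laplacian u x) = f (u x)
  singular : Tendsto u (𝓝[≠] 0) atTop

/-- `w(x) = (1/4) |x|² (log (1 / |x|²) + 1)`. -/
def wFun (x : Plane) : ℝ := 1 / 4 * ‖x‖ ^ 2 * (log (1 / ‖x‖ ^ 2) + 1)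

end SingularSol

end

namespace SingularSol

/-! ### Tail integrals: derivative, decay at infinity, and a comparison principle. -/

section TailIntegral

/-! Growth exponent. Put `t = exp (s ^ q)`, so `f = exp t`, and `a = 1 - 1 / q`. Repeated
integration by parts expands `f' F` in powers of `1 / t` and `1 / log t`, with an error `O(t⁻³)`
obtained by a monotonicity comparison (`abs_deriv_mul_tailIntegral_sub_corr_le`). Inserted in the
definitions, it gives `1 / B₁[f] = 1 + a / s ^ q + O(s ^ q / t)` and a similar formula for `1 /
B₂[f]`, so both tend to `1`.

Discrepancy. With `L = log (1 / ‖x‖ ^ 2)`, the model has `v = log L`, `G(v) = exp (-L) * (L + 1) /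
4` and `1 / B_i[g] = 1 + O(log L / L)`. From `F(ũ) = G(v)` it follows that `exp (ũ ^ q) ~ L`, hence
`ũ ^ q ~ log L`. The weight is a multiple of `√L`, which kills errors of size `log L / L`. For `q =
1` nothing else remains, since `a = 0`; for `q > 1` the term `a √L / ũ ^ q` diverges.

Singular solution. For `u = y(L)` the equation becomes `y'' = -exp (-L + exp y) / 4`. The function
`log ∘ prof` solves it up to `o(L ^ (-7/2))`. Writing `y = log prof + θ`, the linearized operator is
close to `θ'' + (1 / L + 3 / (16 L ^ 2)) θ`, whose kernel is explicit. Variation of constants from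
infinity turns the equation for `L ^ 2 θ` into a contraction in the sup norm
(`exists_perturbed_oscillator`). Thus `θ = O(L⁻²)`, which is below the claimed error, and comparing
`prof` with `-log w - log (-log w)` gives the asymptotics. -/

theorem hasDerivAt_integral_Ioi {h : ℝ → ℝ} {a x : ℝ}
    (hint : MeasureTheory.IntegrableOn h (Ioi a)) (hc : ContinuousOn h (Ioi a)) (hx : a < x) :
    HasDerivAt (fun y => ∫ τ in Ioi y, h τ) (-h x) x := by
  obtain ⟨b, hab, hbx⟩ := exists_between hx
  have hb : MeasureTheory.IntegrableOn h (Ioi b) := hint.mono_set (Ioi_subset_Ioi hab.le)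
  have h1 : HasDerivAt (fun y => ∫ τ in b..y, h τ) (h x) x := by
    apply intervalIntegral.integral_hasDerivAt_right
    · exact (hc.mono (fun y hy => lt_of_lt_of_le hab
        (by rw [uIcc_of_le hbx.le] at hy; exact hy.1))).intervalIntegrable
    · exact hc.stronglyMeasurableAtFilter isOpen_Ioi x hx
    · exact hc.continuousAt (Ioi_mem_nhds hx)
  have h2 := (hasDerivAt_const x (∫ τ in Ioi b, h τ)).sub h1
  rw [zero_sub] at h2
  refine h2.congr_of_eventuallyEq ?_
  filter_upwards [Ioi_mem_nhds hbx] with y hy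
  rw [Pi.sub_apply, ← intervalIntegral.integral_Ioi_sub_Ioi hb (le_of_lt hy)]
  ring

theorem tendsto_integral_Ioi_zero {h : ℝ → ℝ} {a : ℝ}
    (hint : MeasureTheory.IntegrableOn h (Ioi a)) :
    Tendsto (fun y => ∫ τ in Ioi y, h τ) atTop (𝓝 0) := by
  have h1 := MeasureTheory.intervalIntegral_tendsto_integral_Ioi a hint tendsto_id
  have h2 := (tendsto_const_nhds (x := ∫ τ in Ioi a, h τ)).sub h1
  rw [sub_self] at h2
  refine h2.congr' ?_
  filter_upwards [eventually_ge_atTop a] with y hy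
  rw [id, ← intervalIntegral.integral_Ioi_sub_Ioi hint hy]
  ring

/-- A function on a half-line with nonpositive derivative and limit `0` is nonnegative. -/
theorem nonneg_of_deriv_nonpos_of_tendsto_zero {P P' : ℝ → ℝ} {a : ℝ}
    (hP : ∀ s, a ≤ s → HasDerivAt P (P' s) s) (hP' : ∀ s, a ≤ s → P' s ≤ 0)
    (hlim : Tendsto P atTop (𝓝 0)) : 0 ≤ P a := by
  have hanti : AntitoneOn P (Ici a) := by
    apply antitoneOn_of_deriv_nonpos (convex_Ici a)
    · exact fun s hs => (hP s hs).continuousAt.continuousWithinAt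
    · exact fun s hs => (hP s (interior_subset hs)).differentiableAt.differentiableWithinAt
    · intro s hs
      rw [(hP s (interior_subset hs)).deriv]
      exact hP' s (interior_subset hs)
  refine le_of_tendsto hlim ?_
  filter_upwards [eventually_ge_atTop a] with y hy
  exact hanti self_mem_Ici hy hy

end TailIntegral

/-! ### The nonlinearity, its tail integral and the inverse of the latter. -/

section DoubleExp

variable {q : ℝ}

theorem doubleExp_pos (q s : ℝ) : 0 < doubleExp q s := exp_pos _

theorem le_exp_rpow (hq : 1 ≤ q) {s : ℝ} (hs : 0 < s) : s ≤ exp (s ^ q) := by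
  rcases le_total s 1 with h | h
  · exact h.trans (one_le_exp (rpow_nonneg hs.le q))
  · have h1 : s ≤ s ^ q := by
      simpa using rpow_le_rpow_of_exponent_le h hq
    linarith [add_one_le_exp (s ^ q)]

theorem one_div_doubleExp_le (hq : 1 ≤ q) {s : ℝ} (hs : 0 < s) :
    1 / doubleExp q s ≤ exp (-s) := by
  rw [doubleExp, one_div, ← exp_neg, exp_le_exp]
  linarith [le_exp_rpow hq hs]

theorem continuous_one_div_doubleExp (hq : 1 ≤ q) :
    Continuous (fun s => 1 / doubleExp q s) := by
  have : Continuous (fun s : ℝ => s ^ q) := continuous_rpow_const (by linarith)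
  exact continuous_const.div (continuous_exp.comp (continuous_exp.comp this))
    (fun s => (doubleExp_pos q s).ne')

theorem integrableOn_one_div_doubleExp (hq : 1 ≤ q) :
    MeasureTheory.IntegrableOn (fun τ => 1 / doubleExp q τ) (Ioi 0) := by
  have h := exp_neg_integrableOn_Ioi 0 (b := 1) one_pos
  refine MeasureTheory.Integrable.mono' h
    (continuous_one_div_doubleExp hq).aestronglyMeasurable.restrict ?_
  refine (MeasureTheory.ae_restrict_iff' measurableSet_Ioi).2 (Eventually.of_forall ?_)
  intro s hs
  rw [norm_of_nonneg (one_div_pos.2 (doubleExp_pos q s)).le]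
  simpa using one_div_doubleExp_le hq hs

theorem hasDerivAt_tailIntegral_doubleExp (hq : 1 ≤ q) {s : ℝ} (hs : 0 < s) :
    HasDerivAt (tailIntegral (doubleExp q)) (-(1 / doubleExp q s)) s :=
  hasDerivAt_integral_Ioi (integrableOn_one_div_doubleExp hq)
    (continuous_one_div_doubleExp hq).continuousOn hs

theorem tendsto_tailIntegral_doubleExp (hq : 1 ≤ q) :
    Tendsto (tailIntegral (doubleExp q)) atTop (𝓝 0) :=
  tendsto_integral_Ioi_zero (integrableOn_one_div_doubleExp hq)

theorem continuousOn_tailIntegral_doubleExp (hq : 1 ≤ q) :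
    ContinuousOn (tailIntegral (doubleExp q)) (Ioi 0) :=
  fun _ hs => (hasDerivAt_tailIntegral_doubleExp hq hs).continuousAt.continuousWithinAt

theorem strictAntiOn_tailIntegral_doubleExp (hq : 1 ≤ q) :
    StrictAntiOn (tailIntegral (doubleExp q)) (Ioi 0) := by
  apply strictAntiOn_of_deriv_neg (convex_Ioi 0) (continuousOn_tailIntegral_doubleExp hq)
  intro s hs
  rw [interior_Ioi] at hs
  rw [(hasDerivAt_tailIntegral_doubleExp hq hs).deriv]
  exact neg_neg_of_pos (one_div_pos.2 (doubleExp_pos q s))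

theorem tailIntegral_doubleExp_pos (hq : 1 ≤ q) {s : ℝ} (hs : 0 < s) :
    0 < tailIntegral (doubleExp q) s := by
  have h1 : tailIntegral (doubleExp q) (s + 1) < tailIntegral (doubleExp q) s :=
    strictAntiOn_tailIntegral_doubleExp hq hs (by simp; linarith) (by linarith)
  refine lt_of_le_of_lt (nonneg_of_deriv_nonpos_of_tendsto_zero
    (P' := fun s => -(1 / doubleExp q s)) (fun y hy =>
    hasDerivAt_tailIntegral_doubleExp hq (by linarith)) (fun y _ => ?_)
    (tendsto_tailIntegral_doubleExp hq)) h1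
  exact (neg_neg_of_pos (one_div_pos.2 (doubleExp_pos q y))).le

/-- Intermediate values between `1` and a point where `F` drops below `w`. The bound by `F(1)` keeps
the interval inside the open half-line on which continuity of `F` is established. -/
theorem tailInverse_doubleExp_spec (hq : 1 ≤ q) {w : ℝ} (hw : 0 < w)
    (hw1 : w ≤ tailIntegral (doubleExp q) 1) :
    0 < tailInverse (doubleExp q) w ∧
      tailIntegral (doubleExp q) (tailInverse (doubleExp q) w) = w := by
  have hex : ∃ s ∈ Ioi (0 : ℝ), tailIntegral (doubleExp q) s = w := by
    obtain ⟨b, hb, hb1⟩ := (((tendsto_tailIntegral_doubleExp hq).eventually (gt_mem_nhds hw)).and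
      (eventually_ge_atTop 1)).exists
    have hc : ContinuousOn (tailIntegral (doubleExp q)) (Icc 1 b) :=
      (continuousOn_tailIntegral_doubleExp hq).mono fun y hy => lt_of_lt_of_le one_pos hy.1
    obtain ⟨s, hs, hsw⟩ := intermediate_value_Icc' hb1 hc ⟨hb.le, hw1⟩
    exact ⟨s, lt_of_lt_of_le one_pos hs.1, hsw⟩
  exact ⟨Function.invFunOn_mem hex, Function.invFunOn_eq hex⟩

theorem tendsto_tailInverse_doubleExp (hq : 1 ≤ q) :
    Tendsto (tailInverse (doubleExp q)) (𝓝[>] 0) atTop := by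
  refine tendsto_atTop.2 fun M => ?_
  have hM : (0 : ℝ) < max M 1 := lt_max_of_lt_right one_pos
  have h1 := tailIntegral_doubleExp_pos hq hM
  have h2 := tailIntegral_doubleExp_pos hq one_pos
  filter_upwards [Ioo_mem_nhdsGT h1, Ioo_mem_nhdsGT h2] with w hw hw1
  obtain ⟨h3, h4⟩ := tailInverse_doubleExp_spec hq hw.1 hw1.2.le
  by_contra hcon
  rw [not_le] at hcon
  have := strictAntiOn_tailIntegral_doubleExp hq h3 hM (lt_max_of_lt_left hcon)
  rw [h4] at this
  exact lt_asymm this hw.2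

end DoubleExp

/-! ### Size of the coefficients in the expansion of `f' F`. -/

section Expansion

/-- For `φ(s) = exp (s ^ q)` and `a = 1 - 1 / q`, the value of `φ'' / φ' ^ 2` in terms of
`t = φ(s)`. -/
noncomputable def curv (a t : ℝ) : ℝ := 1 / t + a / (t * log t)

/-- The derivative of `curv a`. -/
noncomputable def curvD (a t : ℝ) : ℝ := -(1 / t ^ 2) - a / (t ^ 2 * log t) - a / (t ^ 2 * log t ^ 2)

/-- The second derivative of `curv a`. -/
noncomputable def curvDD (a t : ℝ) : ℝ :=
  2 / t ^ 3 + 2 * a / (t ^ 3 * log t) + 3 * a / (t ^ 3 * log t ^ 2) + 2 * a / (t ^ 3 * log t ^ 3)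

/-- Second order expansion of `f' F`. -/
noncomputable def corr (a t : ℝ) : ℝ := 1 - curv a t + curv a t ^ 2 - curvD a t

/-- The remainder of the expansion `corr`. -/
noncomputable def corrRem (a t : ℝ) : ℝ := curv a t ^ 3 - 3 * curv a t * curvD a t + curvDD a t

variable {a t : ℝ}

theorem hasDerivAt_curv (ht : 1 < t) : HasDerivAt (curv a) (curvD a t) t := by
  have h0 : t ≠ 0 := by linarith
  have hl : log t ≠ 0 := (log_pos ht).ne'
  have h1 := (hasDerivAt_inv h0).add
    (((hasDerivAt_id t).mul (hasDerivAt_log h0)).inv (mul_ne_zero h0 hl) |>.const_mul a)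
  refine (h1.congr_deriv ?_).congr_of_eventuallyEq (Eventually.of_forall fun y => ?_)
  · simp only [curvD, id, Pi.mul_apply]
    field_simp
    ring
  · simp [curv, div_eq_mul_inv]

theorem hasDerivAt_curvD (ht : 1 < t) : HasDerivAt (curvD a) (curvDD a t) t := by
  have h0 : t ≠ 0 := by linarith
  have hl : log t ≠ 0 := (log_pos ht).ne'
  have hlog := hasDerivAt_log h0
  have hsq := hasDerivAt_pow 2 t
  have h1 := ((hsq.inv (pow_ne_zero 2 h0)).neg.sub
    ((hsq.mul hlog).inv (mul_ne_zero (pow_ne_zero 2 h0) hl) |>.const_mul a)).sub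
    ((hsq.mul (hlog.pow 2)).inv (mul_ne_zero (pow_ne_zero 2 h0) (pow_ne_zero 2 hl)) |>.const_mul a)
  refine (h1.congr_deriv ?_).congr_of_eventuallyEq (Eventually.of_forall fun y => ?_)
  · simp only [curvDD, Pi.mul_apply, Pi.pow_apply]
    field_simp
    ring
  · simp [curvD, div_eq_mul_inv]

theorem curv_mul (ht : 1 < t) : t * curv a t = 1 + a / log t := by
  have h0 : t ≠ 0 := by linarith
  have hl : log t ≠ 0 := (log_pos ht).ne'
  rw [curv]; field_simp

theorem curvD_mul (ht : 1 < t) : t ^ 2 * curvD a t = -(1 + a / log t + a / log t ^ 2) := by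
  have h0 : t ≠ 0 := by linarith
  have hl : log t ≠ 0 := (log_pos ht).ne'
  rw [curvD]; field_simp; ring

theorem curvDD_mul (ht : 1 < t) :
    t ^ 3 * curvDD a t = 2 + 2 * (a / log t) + 3 * (a / log t ^ 2) + 2 * (a / log t ^ 3) := by
  have h0 : t ≠ 0 := by linarith
  have hl : log t ≠ 0 := (log_pos ht).ne'
  rw [curvDD]; field_simp

theorem div_log_pow_mem (ha : 0 ≤ a) (ha1 : a ≤ 1) (ht : exp 1 ≤ t) (n : ℕ) :
    0 ≤ a / log t ^ n ∧ a / log t ^ n ≤ 1 := by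
  have hl : 1 ≤ log t := (le_log_iff_exp_le (by linarith [exp_pos 1])).2 ht
  have := one_le_pow₀ hl (n := n)
  exact ⟨by positivity, (div_le_one (by positivity)).2 (ha1.trans this)⟩

/-- For `log t ≥ 1` and `0 ≤ a ≤ 1` every quotient `a / log t ^ n` lies in `[0, 1]`; the constants
add up the coefficients, e.g. `9 = 2 + 2 + 3 + 2`. -/
theorem curv_bounds (ha : 0 ≤ a) (ha1 : a ≤ 1) (ht : exp 1 ≤ t) :
    0 ≤ t * curv a t ∧ t * curv a t ≤ 2 ∧ -3 ≤ t ^ 2 * curvD a t ∧ t ^ 2 * curvD a t ≤ 0 ∧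
      0 ≤ t ^ 3 * curvDD a t ∧ t ^ 3 * curvDD a t ≤ 9 := by
  have h1 : 1 < t := lt_of_lt_of_le (by simp) ht
  obtain ⟨b1, b2⟩ := div_log_pow_mem ha ha1 ht 1
  obtain ⟨b3, b4⟩ := div_log_pow_mem ha ha1 ht 2
  obtain ⟨b5, b6⟩ := div_log_pow_mem ha ha1 ht 3
  rw [pow_one] at b1 b2
  rw [curv_mul h1, curvD_mul h1, curvDD_mul h1]
  refine ⟨?_, ?_, ?_, ?_, ?_, ?_⟩ <;> linarith

/-- All three terms scale like `t⁻³`, and `35 = 2 ^ 3 + 3 * 6 + 9`. -/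
theorem abs_corrRem_le (ha : 0 ≤ a) (ha1 : a ≤ 1) (ht : exp 1 ≤ t) :
    |corrRem a t| ≤ 35 / t ^ 3 := by
  have h0 : 0 < t := lt_of_lt_of_le (exp_pos 1) ht
  obtain ⟨b1, b2, b3, b4, b5, b6⟩ := curv_bounds ha ha1 ht
  rw [le_div_iff₀ (by positivity), ← abs_of_pos (pow_pos h0 3), ← abs_mul]
  have : corrRem a t * t ^ 3 = (t * curv a t) ^ 3 + 3 * ((t * curv a t) * -(t ^ 2 * curvD a t))
      + t ^ 3 * curvDD a t := by rw [corrRem]; ring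
  rw [this]
  have c1 : (t * curv a t) ^ 3 ≤ 2 ^ 3 := pow_le_pow_left₀ b1 b2 3
  have c2 : (t * curv a t) * -(t ^ 2 * curvD a t) ≤ 2 * 3 := by
    apply mul_le_mul b2 (by linarith) (by linarith) (by norm_num)
  have c3 : 0 ≤ (t * curv a t) * -(t ^ 2 * curvD a t) := mul_nonneg b1 (by linarith)
  rw [abs_of_nonneg (by positivity)]
  linarith

theorem abs_corr_sub_le (ha : 0 ≤ a) (ha1 : a ≤ 1) (ht : exp 1 ≤ t) :
    |corr a t - 1 + curv a t| ≤ 7 / t ^ 2 := by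
  have h0 : 0 < t := lt_of_lt_of_le (exp_pos 1) ht
  obtain ⟨b1, b2, b3, b4, -, -⟩ := curv_bounds ha ha1 ht
  rw [le_div_iff₀ (by positivity), ← abs_of_pos (pow_pos h0 2), ← abs_mul]
  have : (corr a t - 1 + curv a t) * t ^ 2 = (t * curv a t) ^ 2 - t ^ 2 * curvD a t := by
    rw [corr]; ring
  have c1 : (t * curv a t) ^ 2 ≤ 2 ^ 2 := pow_le_pow_left₀ b1 b2 2
  rw [this, abs_of_nonneg (by nlinarith)]
  linarith

end Expansion

/-! ### Derivatives of the nonlinearity and the comparison argument for `f' F`. -/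

section Derivatives

variable {q s : ℝ}

/-- The derivative of `exp (s ^ q)`. -/
noncomputable def expPowD (q s : ℝ) : ℝ := q * s ^ (q - 1) * exp (s ^ q)

theorem hasDerivAt_exp_rpow (hs : 0 < s) : HasDerivAt (fun y => exp (y ^ q)) (expPowD q s) s := by
  have := (hasDerivAt_rpow_const (p := q) (Or.inl hs.ne')).exp
  exact this.congr_deriv (by rw [expPowD]; ring)

theorem expPowD_pos (hq : 1 ≤ q) (hs : 0 < s) : 0 < expPowD q s := by
  rw [expPowD]
  have := rpow_pos_of_pos hs (q - 1)
  have := exp_pos (s ^ q)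
  positivity

theorem one_le_expPowD (hq : 1 ≤ q) (hs : 1 ≤ s) : 1 ≤ expPowD q s := by
  rw [expPowD]
  have h1 : 1 ≤ s ^ (q - 1) := one_le_rpow hs (by linarith)
  have h2 : 1 ≤ exp (s ^ q) := one_le_exp (rpow_nonneg (by linarith) q)
  exact one_le_mul_of_one_le_of_one_le (one_le_mul_of_one_le_of_one_le hq h1) h2

theorem hasDerivAt_doubleExp (hs : 0 < s) :
    HasDerivAt (doubleExp q) (doubleExp q s * expPowD q s) s :=
  (hasDerivAt_exp_rpow hs).exp

theorem deriv_doubleExp (hs : 0 < s) : deriv (doubleExp q) s = doubleExp q s * expPowD q s :=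
  (hasDerivAt_doubleExp hs).deriv

theorem hasDerivAt_expPowD (hq : 1 ≤ q) (hs : 0 < s) :
    HasDerivAt (expPowD q) (expPowD q s ^ 2 * curv (1 - 1 / q) (exp (s ^ q))) s := by
  have h1 := ((hasDerivAt_rpow_const (p := q - 1) (Or.inl hs.ne')).const_mul q).mul
    (hasDerivAt_exp_rpow (q := q) hs)
  refine h1.congr_deriv ?_
  have hp := rpow_pos_of_pos hs q
  have e1 : s ^ (q - 1) = s ^ q / s := rpow_sub_one hs.ne' q
  have e2 : s ^ (q - 1 - 1) = s ^ q / s / s := by rw [rpow_sub_one hs.ne', e1]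
  have hE := exp_pos (s ^ q)
  rw [curv, log_exp, expPowD, e1, e2]
  have hq0 : q ≠ 0 := by linarith
  field_simp
  ring

theorem hasDerivAt_deriv_doubleExp (hq : 1 ≤ q) (hs : 0 < s) :
    HasDerivAt (deriv (doubleExp q))
      (doubleExp q s * expPowD q s ^ 2 * (1 + curv (1 - 1 / q) (exp (s ^ q)))) s := by
  have h1 := (hasDerivAt_doubleExp (q := q) hs).mul (hasDerivAt_expPowD hq hs)
  have h2 : deriv (doubleExp q) =ᶠ[𝓝 s] doubleExp q * expPowD q := by
    filter_upwards [Ioi_mem_nhds hs] with y hy using deriv_doubleExp hy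
  exact (h1.congr_of_eventuallyEq h2).congr_deriv (by ring)

/-- With `c = curv` and primes on `N`, `c` for `d/dt`, one has `(N / f')' = (N' - N (1 + c)) / f`.
An exact `N = f' F` would satisfy `N = 1 - c N + N'`; two iterations from `N = 1` give `corr`, and
the third-order defect is `corrRem`. -/
theorem hasDerivAt_corr_div (hq : 1 ≤ q) (hs : 0 < s) :
    HasDerivAt (fun y => corr (1 - 1 / q) (exp (y ^ q)) / deriv (doubleExp q) y)
      (-(1 / doubleExp q s) * (1 + corrRem (1 - 1 / q) (exp (s ^ q)))) s := by
  generalize ha : 1 - 1 / q = a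
  have ht : 1 < exp (s ^ q) := by simpa using rpow_pos_of_pos hs q
  have hf := doubleExp_pos q s
  have hp := expPowD_pos hq hs
  have hd := hasDerivAt_curv (a := a) ht
  have hf2 := hasDerivAt_deriv_doubleExp hq hs
  rw [ha] at hf2
  have hN : HasDerivAt (corr a) (-curvD a (exp (s ^ q)) + 2 * curv a (exp (s ^ q)) *
      curvD a (exp (s ^ q)) - curvDD a (exp (s ^ q))) (exp (s ^ q)) := by
    have := (((hasDerivAt_const _ (1 : ℝ)).sub hd).add (hd.pow 2)).sub (hasDerivAt_curvD (a := a) ht)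
    refine this.congr_deriv ?_
    simp
  have h1 := (hN.comp s (hasDerivAt_exp_rpow (q := q) hs)).div hf2
    (by rw [deriv_doubleExp hs]; positivity)
  refine h1.congr_deriv ?_
  simp only [Function.comp]
  rw [deriv_doubleExp hs, corrRem, corr]
  field_simp
  ring

theorem abs_corr_le {a t : ℝ} (ha : 0 ≤ a) (ha1 : a ≤ 1) (ht : exp 1 ≤ t) : |corr a t| ≤ 10 := by
  have h1 : 1 ≤ t := (one_le_exp zero_le_one).trans ht
  obtain ⟨b1, b2, -, -, -, -⟩ := curv_bounds ha ha1 ht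
  have h2 : 7 / t ^ 2 ≤ 7 := div_le_self (by norm_num) (one_le_pow₀ h1)
  have h3 := abs_le.1 ((abs_corr_sub_le ha ha1 ht).trans h2)
  have h4 : 0 ≤ curv a t := nonneg_of_mul_nonneg_right b1 (by linarith)
  have h5 : curv a t ≤ 2 := by nlinarith
  rw [abs_le]; constructor <;> linarith [h3.1, h3.2]

theorem one_sub_inv_mem (hq : 1 ≤ q) : 0 ≤ 1 - 1 / q ∧ 1 - 1 / q ≤ 1 := by
  have : 1 / q ≤ 1 := (div_le_one (by linarith)).2 hq
  have : 0 < 1 / q := by positivity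
  constructor <;> linarith

theorem exp_one_le_exp_rpow (hq : 1 ≤ q) (hs : 1 ≤ s) : exp 1 ≤ exp (s ^ q) :=
  exp_le_exp.2 (one_le_rpow hs (by linarith))

theorem tendsto_corr_div (hq : 1 ≤ q) :
    Tendsto (fun y => corr (1 - 1 / q) (exp (y ^ q)) / deriv (doubleExp q) y) atTop (𝓝 0) := by
  have h0 : Tendsto (fun y : ℝ => 10 * exp (-y)) atTop (𝓝 0) := by
    simpa using (tendsto_exp_neg_atTop_nhds_zero.const_mul (10 : ℝ))
  refine squeeze_zero_norm' ?_ h0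
  filter_upwards [eventually_ge_atTop 1] with y hy
  have hy0 : 0 < y := by linarith
  have h1 := abs_corr_le (one_sub_inv_mem hq).1 (one_sub_inv_mem hq).2 (exp_one_le_exp_rpow hq hy)
  have h2 := one_le_expPowD hq hy
  have h3 := doubleExp_pos q y
  have h4 := one_div_doubleExp_le hq hy0
  rw [deriv_doubleExp hy0, norm_eq_abs, abs_div, abs_of_pos (mul_pos h3 (by linarith))]
  calc _ ≤ 10 / doubleExp q y := div_le_div₀ (by norm_num) h1 h3 (by nlinarith)
    _ = 10 * (1 / doubleExp q y) := by ring
    _ ≤ _ := by linarith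

/-- The second order expansion of `f' F`. -/
theorem abs_deriv_mul_tailIntegral_sub_corr_le (hq : 1 ≤ q) (hs : 1 ≤ s) :
    |deriv (doubleExp q) s * tailIntegral (doubleExp q) s - corr (1 - 1 / q) (exp (s ^ q))| ≤
      35 / exp (s ^ q) ^ 3 * (deriv (doubleExp q) s * tailIntegral (doubleExp q) s) := by
  set a := 1 - 1 / q with ha
  set κ := 35 / exp (s ^ q) ^ 3 with hκ
  have hs0 : 0 < s := by linarith
  have hf' : 0 < deriv (doubleExp q) s := by
    rw [deriv_doubleExp hs0]; exact mul_pos (doubleExp_pos q s) (expPowD_pos hq hs0)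
  have hrem : ∀ y, s ≤ y → |corrRem a (exp (y ^ q))| ≤ κ := by
    intro y hy
    refine (abs_corrRem_le (one_sub_inv_mem hq).1 (one_sub_inv_mem hq).2
      (exp_one_le_exp_rpow hq (hs.trans hy))).trans ?_
    have : exp (s ^ q) ≤ exp (y ^ q) := exp_le_exp.2 (rpow_le_rpow hs0.le hy (by linarith))
    rw [hκ]
    gcongr
  have hF := fun y (hy : s ≤ y) => hasDerivAt_tailIntegral_doubleExp hq (lt_of_lt_of_le hs0 hy)
  have hP := fun y (hy : s ≤ y) => hasDerivAt_corr_div hq (lt_of_lt_of_le hs0 hy)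
  have hlim := tendsto_tailIntegral_doubleExp hq
  -- Both `(1 + κ) F - corr / f'` and `corr / f' - (1 - κ) F` are nonincreasing on `[s, ∞)` and
  -- vanish at infinity, so both are nonnegative at `s`.
  have up := nonneg_of_deriv_nonpos_of_tendsto_zero
    (fun y hy => ((hF y hy).const_mul (1 + κ)).sub (hP y hy))
    (fun y hy => by
      have h1 := one_div_pos.2 (doubleExp_pos q y)
      have h2 := abs_le.1 (hrem y hy)
      nlinarith [h2.1, h2.2])
    (by convert (hlim.const_mul (1 + κ)).sub (tendsto_corr_div hq) using 2 <;> simp)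
  have lo := nonneg_of_deriv_nonpos_of_tendsto_zero
    (fun y hy => (hP y hy).sub ((hF y hy).const_mul (1 - κ)))
    (fun y hy => by
      have h1 := one_div_pos.2 (doubleExp_pos q y)
      have h2 := abs_le.1 (hrem y hy)
      nlinarith [h2.1, h2.2])
    (by convert (tendsto_corr_div hq).sub (hlim.const_mul (1 - κ)) using 2 <;> simp)
  simp only [Pi.sub_apply] at up lo
  rw [sub_nonneg, div_le_iff₀ hf'] at up
  rw [sub_nonneg, le_div_iff₀ hf'] at lo
  rw [abs_le]
  constructor <;> linarith

end Derivatives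

/-! ### Expansions of `1 / B₁[f]` and `1 / B₂[f]`; growth exponent. -/

section Asymptotics

/-- Boundedness of the product of the limits is returned as well, so that the estimate can be
iterated over several factors. -/
theorem isBigO_mul_sub_mul {α : Type*} {l : Filter α} {X x Y y e : α → ℝ}
    (hX : (fun s => X s - x s) =O[l] e) (hY : (fun s => Y s - y s) =O[l] e)
    (hx : x =O[l] (fun _ => (1 : ℝ))) (hy : y =O[l] (fun _ => (1 : ℝ)))
    (he : e =O[l] (fun _ => (1 : ℝ))) :
    (fun s => X s * Y s - x s * y s) =O[l] e ∧ (fun s => x s * y s) =O[l] (fun _ => (1 : ℝ)) := by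
  have hY1 : Y =O[l] (fun _ => (1 : ℝ)) := by simpa using (hY.trans he).add hy
  constructor
  · have h1 := hX.mul hY1
    have h2 := hx.mul hY
    simp only [mul_one, one_mul] at h1 h2
    exact (h1.add h2).congr_left fun s => by ring
  · simpa using hx.mul hy

variable {q : ℝ}

/-- `f' F` for `f = doubleExp q`. -/
noncomputable def derivTail (q s : ℝ) : ℝ :=
  deriv (doubleExp q) s * tailIntegral (doubleExp q) s

theorem derivTail_pos (hq : 1 ≤ q) {s : ℝ} (hs : 0 < s) : 0 < derivTail q s := by
  rw [derivTail, deriv_doubleExp hs]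
  exact mul_pos (mul_pos (doubleExp_pos q s) (expPowD_pos hq hs)) (tailIntegral_doubleExp_pos hq hs)

theorem tendsto_exp_rpow (hq : 1 ≤ q) : Tendsto (fun s : ℝ => exp (s ^ q)) atTop atTop :=
  tendsto_exp_atTop.comp (tendsto_rpow_atTop (by linarith))

theorem abs_derivTail_sub_corr_le (hq : 1 ≤ q) : ∀ᶠ s in atTop,
    |derivTail q s - corr (1 - 1 / q) (exp (s ^ q))| ≤ 700 / exp (s ^ q) ^ 3 := by
  filter_upwards [eventually_ge_atTop 1, (tendsto_exp_rpow hq).eventually_ge_atTop 70] with s hs ht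
  have h1 : |derivTail q s - _| ≤ _ * derivTail q s :=
    abs_deriv_mul_tailIntegral_sub_corr_le hq hs
  have h2 := abs_corr_le (one_sub_inv_mem hq).1 (one_sub_inv_mem hq).2 (exp_one_le_exp_rpow hq hs)
  have h3 := derivTail_pos hq (lt_of_lt_of_le one_pos hs)
  -- Half of `derivTail` can then be absorbed: `|corr| ≤ 10` yields `derivTail ≤ 20`, and `700 = 35
  -- * 20`.
  have h4 : 35 / exp (s ^ q) ^ 3 ≤ 1 / 2 := by
    rw [div_le_iff₀ (by positivity)]
    nlinarith [pow_le_pow_left₀ (by norm_num) ht 3]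
  have h5 : derivTail q s ≤ 20 := by
    have := (abs_le.1 h1).2
    have := (abs_le.1 h2).2
    nlinarith
  calc _ ≤ _ := h1
    _ ≤ 35 / exp (s ^ q) ^ 3 * 20 := by gcongr
    _ = _ := by ring

theorem isBigO_one_sub_derivTail (hq : 1 ≤ q) :
    (fun s => exp (s ^ q) * (1 - derivTail q s) - (1 + (1 - 1 / q) / s ^ q)) =O[atTop]
      fun s => (exp (s ^ q))⁻¹ := by
  refine IsBigO.of_bound 707 ?_
  filter_upwards [eventually_ge_atTop 1, abs_derivTail_sub_corr_le hq] with s hs h1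
  have h2 := abs_corr_sub_le (one_sub_inv_mem hq).1 (one_sub_inv_mem hq).2
    (exp_one_le_exp_rpow hq hs)
  have ht1 : 1 < exp (s ^ q) := lt_of_lt_of_le (by simp) (exp_one_le_exp_rpow hq hs)
  have h3 := curv_mul (a := 1 - 1 / q) ht1
  rw [log_exp] at h3
  generalize exp (s ^ q) = t at *
  have ht0 : 0 < t := by linarith
  rw [norm_eq_abs, norm_of_nonneg (by positivity), ← h3]
  calc |t * (1 - derivTail q s) - t * curv (1 - 1 / q) t|
      = t * |-(derivTail q s - corr (1 - 1 / q) t)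
          + -(corr (1 - 1 / q) t - 1 + curv (1 - 1 / q) t)| := by
        rw [← abs_of_pos ht0, ← abs_mul, abs_of_pos ht0]; congr 1; ring
    _ ≤ t * (700 / t ^ 3 + 7 / t ^ 2) := by
        gcongr
        refine (abs_add_le _ _).trans ?_
        rw [abs_neg, abs_neg]
        exact add_le_add h1 h2
    _ = 700 * t⁻¹ * t⁻¹ + 7 * t⁻¹ := by field_simp
    _ ≤ 700 * t⁻¹ * 1 + 7 * t⁻¹ := by gcongr; exact inv_le_one_of_one_le₀ ht1.le
    _ = _ := by ring

/-- In `corr * (1 + curv) - 1 = -curvD + curv ^ 3 - curv * curvD` the terms of order `t⁻¹` cancel,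
so the second-order expansion of `f' F` is needed; the leading term is `-curvD`. -/
theorem isBigO_derivTail_second (hq : 1 ≤ q) :
    (fun s => exp (s ^ q) ^ 2 * (derivTail q s * (1 + curv (1 - 1 / q) (exp (s ^ q))) - 1)
      - (1 + (1 - 1 / q) / s ^ q + (1 - 1 / q) / (s ^ q) ^ 2)) =O[atTop]
      fun s => (exp (s ^ q))⁻¹ := by
  refine IsBigO.of_bound 2114 ?_
  filter_upwards [eventually_ge_atTop 1, abs_derivTail_sub_corr_le hq] with s hs h1
  obtain ⟨b1, b2, b3, b4, -, -⟩ := curv_bounds (one_sub_inv_mem hq).1 (one_sub_inv_mem hq).2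
    (exp_one_le_exp_rpow hq hs)
  have ht1 : 1 < exp (s ^ q) := lt_of_lt_of_le (by simp) (exp_one_le_exp_rpow hq hs)
  have h3 := curvD_mul (a := 1 - 1 / q) ht1
  rw [log_exp] at h3
  generalize exp (s ^ q) = t at *
  generalize 1 - 1 / q = a at *
  have ht0 : 0 < t := by linarith
  have hc0 : 0 ≤ curv a t := nonneg_of_mul_nonneg_right b1 ht0
  have hc2 : curv a t ≤ 2 := by nlinarith
  rw [norm_eq_abs, norm_of_nonneg (by positivity), ← neg_neg (1 + a / s ^ q + _), ← h3]
  have e : t ^ 2 * (derivTail q s * (1 + curv a t) - 1) - -(t ^ 2 * curvD a t) =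
      t ^ 2 * (1 + curv a t) * (derivTail q s - corr a t) +
      ((t * curv a t) ^ 3 - (t * curv a t) * (t ^ 2 * curvD a t)) * t⁻¹ := by
    rw [corr]; field_simp; ring
  have k1 : |t ^ 2 * (1 + curv a t) * (derivTail q s - corr a t)| ≤ 2100 * t⁻¹ := by
    rw [abs_mul, abs_of_nonneg (by positivity)]
    calc _ ≤ t ^ 2 * (1 + 2) * (700 / t ^ 3) := by gcongr
      _ = _ := by field_simp; norm_num
  have k2 : |((t * curv a t) ^ 3 - (t * curv a t) * (t ^ 2 * curvD a t)) * t⁻¹| ≤ 14 * t⁻¹ := by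
    rw [abs_mul, abs_of_pos (inv_pos.2 ht0)]
    have c1 : (t * curv a t) ^ 3 ≤ 2 ^ 3 := pow_le_pow_left₀ b1 b2 3
    have c0 : 0 ≤ (t * curv a t) ^ 3 := by positivity
    have c2 : (t * curv a t) * -(t ^ 2 * curvD a t) ≤ 2 * 3 :=
      mul_le_mul b2 (by linarith) (by linarith) (by norm_num)
    have c3 : 0 ≤ (t * curv a t) * -(t ^ 2 * curvD a t) := mul_nonneg b1 (by linarith)
    gcongr
    rw [abs_le]; constructor <;> linarith
  rw [e]
  refine (abs_add_le _ _).trans ?_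
  linarith

theorem isBigO_inv_exp_rpow (hq : 1 ≤ q) :
    (fun s : ℝ => (exp (s ^ q))⁻¹) =O[atTop] fun s => s ^ q / exp (s ^ q) := by
  refine IsBigO.of_bound 1 ?_
  filter_upwards [eventually_ge_atTop 1] with s hs
  have h1 : 1 ≤ s ^ q := one_le_rpow hs (by linarith)
  rw [norm_of_nonneg (by positivity), norm_of_nonneg (by positivity), one_mul, div_eq_mul_inv]
  exact le_mul_of_one_le_left (by positivity) h1

theorem tendsto_rpow_div_exp_rpow (hq : 1 ≤ q) :
    Tendsto (fun s : ℝ => s ^ q / exp (s ^ q)) atTop (𝓝 0) := by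
  have := (tendsto_pow_mul_exp_neg_atTop_nhds_zero 1).comp
    (tendsto_rpow_atTop (y := q) (by linarith))
  refine this.congr fun s => ?_
  simp [exp_neg, div_eq_mul_inv]

theorem isBigO_one_inv_rpow (hq : 1 ≤ q) (n : ℕ) :
    (fun s : ℝ => (1 - 1 / q) / (s ^ q) ^ n) =O[atTop] fun _ => (1 : ℝ) := by
  refine IsBigO.of_bound 1 ?_
  filter_upwards [eventually_ge_atTop 1] with s hs
  have := div_log_pow_mem (one_sub_inv_mem hq).1 (one_sub_inv_mem hq).2
    (exp_one_le_exp_rpow hq hs) n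
  rw [log_exp] at this
  rw [norm_of_nonneg this.1]
  simpa using this.2

theorem isBigO_derivTail_sub_one (hq : 1 ≤ q) :
    (fun s => derivTail q s - 1) =O[atTop] fun s => s ^ q / exp (s ^ q) := by
  have h1 : (fun s : ℝ => 1 + (1 - 1 / q) / s ^ q) =O[atTop] fun _ => (1 : ℝ) := by
    simpa using (isBigO_refl (fun _ : ℝ => (1 : ℝ)) atTop).add (isBigO_one_inv_rpow hq 1)
  have h2 := (isBigO_one_sub_derivTail hq).trans ((isBigO_inv_exp_rpow hq).trans
    ((tendsto_rpow_div_exp_rpow hq).isBigO_one ℝ))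
  have h3 := (h2.add h1).mul (isBigO_refl (fun s : ℝ => -(exp (s ^ q))⁻¹) atTop)
  simp only [one_mul] at h3
  refine (h3.congr_left fun s => ?_).trans (isBigO_neg_left.2 (isBigO_inv_exp_rpow hq))
  have := exp_pos (s ^ q)
  field_simp
  ring

theorem tailIntegral_eq_derivTail_div {s : ℝ} (hq : 1 ≤ q) (hs : 0 < s) :
    tailIntegral (doubleExp q) s = derivTail q s / (doubleExp q s * expPowD q s) := by
  have h1 := doubleExp_pos q s
  have h2 := expPowD_pos hq hs
  rw [derivTail, deriv_doubleExp hs]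
  field_simp

/-- Since `F = derivTail / f'`, the logarithm is `exp (s ^ q) + log q + (q - 1) log s + s ^ q - log
derivTail`, with last term `o(1)`. -/
theorem isBigO_neg_log_tailIntegral (hq : 1 ≤ q) :
    (fun s => -log (tailIntegral (doubleExp q) s) / exp (s ^ q) - 1) =O[atTop]
      fun s => s ^ q / exp (s ^ q) := by
  refine IsBigO.of_bound (log q + 3) ?_
  have hm : Tendsto (derivTail q) atTop (𝓝 1) := by
    have := (isBigO_derivTail_sub_one hq).trans_tendsto (tendsto_rpow_div_exp_rpow hq)
    simpa using this.add_const 1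
  have hlm : Tendsto (fun s => log (derivTail q s)) atTop (𝓝 0) := by
    simpa using hm.log one_ne_zero
  filter_upwards [eventually_ge_atTop 1, hlm.eventually (Icc_mem_nhds
    (show (-1 : ℝ) < 0 by norm_num) one_pos)] with s hs hl
  have hs0 : 0 < s := by linarith
  have hlq : 0 ≤ log q := log_nonneg hq
  have hℓ : 1 ≤ s ^ q := one_le_rpow hs (by linarith)
  have hE := exp_pos (s ^ q)
  have h1 : -log (tailIntegral (doubleExp q) s) =
      exp (s ^ q) + (log q + (q - 1) * log s + s ^ q) - log (derivTail q s) := by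
    rw [tailIntegral_eq_derivTail_div hq hs0, log_div (derivTail_pos hq hs0).ne'
      (mul_pos (doubleExp_pos q s) (expPowD_pos hq hs0)).ne', log_mul (doubleExp_pos q s).ne'
      (expPowD_pos hq hs0).ne', doubleExp, log_exp, expPowD, log_mul _ hE.ne', log_mul _ _,
      log_rpow hs0, log_exp]
    · ring
    · linarith
    · exact (rpow_pos_of_pos hs0 _).ne'
    · exact mul_ne_zero (by linarith) (rpow_pos_of_pos hs0 _).ne'
  have hls : 0 ≤ log s := log_nonneg hs
  have h2 : q * log s ≤ s ^ q := by
    rw [← log_rpow hs0]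
    linarith [log_le_sub_one_of_pos (rpow_pos_of_pos hs0 q)]
  have h3 : 0 ≤ (q - 1) * log s := mul_nonneg (by linarith) hls
  have h4 : ∀ A D : ℝ, (exp (s ^ q) + A - D) / exp (s ^ q) - 1 = (A - D) / exp (s ^ q) := by
    intros; field_simp; ring
  rw [h1, norm_of_nonneg (r := s ^ q / exp (s ^ q)) (by positivity), ← mul_div_assoc, h4,
    norm_eq_abs, abs_div, abs_of_pos hE]
  gcongr
  rw [abs_le]
  constructor <;> nlinarith [hl.1, hl.2]

/-- Factor as `(-log F / t) * (t (1 - f' F))` with `t = exp (s ^ q)`. -/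
theorem isBigO_invB₁_doubleExp (hq : 1 ≤ q) :
    (fun s => invB₁ (doubleExp q) s - (1 + (1 - 1 / q) / s ^ q)) =O[atTop]
      fun s => s ^ q / exp (s ^ q) := by
  have h1 : (fun s : ℝ => 1 + (1 - 1 / q) / s ^ q) =O[atTop] fun _ => (1 : ℝ) := by
    simpa using (isBigO_refl (fun _ : ℝ => (1 : ℝ)) atTop).add (isBigO_one_inv_rpow hq 1)
  have h2 := (isBigO_mul_sub_mul (isBigO_neg_log_tailIntegral hq)
    ((isBigO_one_sub_derivTail hq).trans (isBigO_inv_exp_rpow hq)) (isBigO_refl _ _) h1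
    ((tendsto_rpow_div_exp_rpow hq).isBigO_one ℝ)).1
  refine h2.congr_left fun s => ?_
  have := exp_pos (s ^ q)
  rw [invB₁, ← derivTail]
  field_simp

/-- Because `f f'' F / f' = f' F (1 + curv)`, the expression is `f' F * (-log F / t) ^ 2 * t ^ 2 (f'
F (1 + curv) - 1)`. -/
theorem isBigO_invB₂_doubleExp (hq : 1 ≤ q) :
    (fun s => invB₂ (doubleExp q) s - (1 + (1 - 1 / q) / s ^ q + (1 - 1 / q) / (s ^ q) ^ 2))
      =O[atTop] fun s => s ^ q / exp (s ^ q) := by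
  have h1 : (fun s : ℝ => 1 + (1 - 1 / q) / s ^ q + (1 - 1 / q) / (s ^ q) ^ 2) =O[atTop]
      fun _ => (1 : ℝ) := by
    simpa using ((isBigO_refl (fun _ : ℝ => (1 : ℝ)) atTop).add (isBigO_one_inv_rpow hq 1)).add
      (isBigO_one_inv_rpow hq 2)
  have he := (tendsto_rpow_div_exp_rpow hq).isBigO_one ℝ
  have h2 := isBigO_mul_sub_mul (isBigO_neg_log_tailIntegral hq) (isBigO_neg_log_tailIntegral hq)
    (isBigO_refl _ _) (isBigO_refl _ _) he
  have h3 := isBigO_mul_sub_mul (isBigO_derivTail_sub_one hq) h2.1 (isBigO_refl _ _) h2.2 he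
  have h4 := (isBigO_mul_sub_mul h3.1 ((isBigO_derivTail_second hq).trans (isBigO_inv_exp_rpow hq))
    h3.2 h1 he).1
  refine h4.congr' ?_ EventuallyEq.rfl
  filter_upwards [eventually_gt_atTop 0] with s hs
  have hE := exp_pos (s ^ q)
  have hf := doubleExp_pos q s
  have hp := expPowD_pos hq hs
  have e : doubleExp q s * deriv (deriv (doubleExp q)) s * tailIntegral (doubleExp q) s /
      deriv (doubleExp q) s = derivTail q s * (1 + curv (1 - 1 / q) (exp (s ^ q))) := by
    rw [(hasDerivAt_deriv_doubleExp hq hs).deriv, derivTail, deriv_doubleExp hs]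
    field_simp
  rw [invB₂, e, ← derivTail]
  field_simp

theorem tendsto_one_sub_inv_div_rpow (hq : 1 ≤ q) {n : ℕ} (hn : n ≠ 0) :
    Tendsto (fun s : ℝ => (1 - 1 / q) / (s ^ q) ^ n) atTop (𝓝 0) :=
  ((tendsto_pow_atTop hn).comp (tendsto_rpow_atTop (y := q) (by linarith))).const_div_atTop _

theorem hasGrowthExponent_doubleExp (hq : 1 ≤ q) : HasGrowthExponent (doubleExp q) 1 := by
  constructor
  · filter_upwards [eventually_ge_atTop 0] with s hs
    exact (integrableOn_one_div_doubleExp hq).mono_set (Ioi_subset_Ioi hs)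
  · have h1 := (isBigO_invB₂_doubleExp hq).trans_tendsto (tendsto_rpow_div_exp_rpow hq)
    have h2 := (tendsto_one_sub_inv_div_rpow hq one_ne_zero).const_add 1 |>.add
      (tendsto_one_sub_inv_div_rpow hq two_ne_zero)
    have h3 : Tendsto (invB₂ (doubleExp q)) atTop (𝓝 1) := by
      simpa using h1.add h2
    have h4 := h3.inv₀ one_ne_zero
    rw [inv_one] at h4
    exact h4.congr fun s => (one_div _).symm

end Asymptotics

/-! ### The model nonlinearity in closed form, in the variable `L = exp s`. -/

section Model

theorem modelNonlinearity_one_eq :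
    modelNonlinearity 1 = fun s => 4 * exp (exp s) / exp (2 * s) := by
  funext s; rw [modelNonlinearity, if_pos rfl]

theorem hasDerivAt_modelNonlinearity_one (s : ℝ) :
    HasDerivAt (modelNonlinearity 1) (modelNonlinearity 1 s * (exp s - 2)) s := by
  rw [modelNonlinearity_one_eq]
  have h2 : HasDerivAt (fun y : ℝ => exp (2 * y)) (exp (2 * s) * 2) s := by
    simpa using ((hasDerivAt_id s).const_mul (2 : ℝ)).exp
  refine (((hasDerivAt_exp s).exp.const_mul 4).div h2 (exp_pos _).ne').congr_deriv ?_
  have := exp_pos (2 * s)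
  field_simp

theorem deriv_modelNonlinearity_one :
    deriv (modelNonlinearity 1) = fun s => modelNonlinearity 1 s * (exp s - 2) :=
  funext fun s => (hasDerivAt_modelNonlinearity_one s).deriv

theorem deriv_deriv_modelNonlinearity_one (s : ℝ) :
    deriv (deriv (modelNonlinearity 1)) s =
      modelNonlinearity 1 s * ((exp s - 2) ^ 2 + exp s) := by
  rw [deriv_modelNonlinearity_one]
  refine (((hasDerivAt_modelNonlinearity_one s).mul
    ((hasDerivAt_exp s).sub_const 2)).congr_deriv ?_).deriv
  ring

/-- The explicit value of `G` at `log L`. -/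
noncomputable def modelTail (L : ℝ) : ℝ := exp (-L) * (L + 1) / 4

theorem tendsto_modelTail : Tendsto modelTail atTop (𝓝 0) := by
  have h1 := (tendsto_pow_mul_exp_neg_atTop_nhds_zero 1).add (tendsto_pow_mul_exp_neg_atTop_nhds_zero 0)
  have h2 := h1.div_const 4
  simp only [add_zero, zero_div] at h2
  refine h2.congr fun L => ?_
  rw [modelTail]; ring

theorem tailIntegral_modelNonlinearity_one (s : ℝ) :
    tailIntegral (modelNonlinearity 1) s = modelTail (exp s) := by
  have h1 : ∀ y ∈ Ici s, HasDerivAt (fun y => -modelTail (exp y))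
      (1 / modelNonlinearity 1 y) y := by
    intro y _
    have h0 := hasDerivAt_exp y
    refine ((((h0.neg.exp).mul (h0.add_const 1)).div_const 4).neg).congr_deriv ?_
    simp only [modelNonlinearity_one_eq, two_mul, Pi.neg_apply, exp_add, exp_neg]
    have := exp_pos (exp y)
    field_simp
    ring
  have h2 := MeasureTheory.integral_Ioi_of_hasDerivAt_of_nonneg' h1
    (fun y _ => by rw [modelNonlinearity_one_eq]; positivity)
    (by simpa using (tendsto_modelTail.comp tendsto_exp_atTop).neg)
  rw [tailIntegral, h2]; ring

theorem modelTail_pos {L : ℝ} (hL : 0 < L) : 0 < modelTail L := by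
  rw [modelTail]; positivity

theorem neg_log_modelTail {L : ℝ} (hL : 0 < L) :
    -log (modelTail L) = L - log (L + 1) + log 4 := by
  have := exp_pos (-L)
  rw [modelTail, log_div (by positivity) (by norm_num), log_mul (by positivity) (by positivity),
    log_exp]
  ring

theorem modelNonlinearity_mul_modelTail {L : ℝ} (hL : 0 < L) :
    modelNonlinearity 1 (log L) * modelTail L = (L + 1) / L ^ 2 := by
  simp only [modelNonlinearity_one_eq, modelTail, two_mul, exp_add, exp_neg, exp_log hL]
  have := exp_pos L
  field_simp

theorem invB₁_model {L : ℝ} (hL : 0 < L) : invB₁ (modelNonlinearity 1) (log L) =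
    (-log (modelTail L) / L) * (1 + 2 / L) := by
  have h := modelNonlinearity_mul_modelTail hL
  rw [invB₁, tailIntegral_modelNonlinearity_one, deriv_modelNonlinearity_one, exp_log hL]
  have e : modelNonlinearity 1 (log L) * (L - 2) * modelTail L = (L - 2) * ((L + 1) / L ^ 2) := by
    rw [← h]; ring
  beta_reduce
  rw [exp_log hL, e]
  field_simp
  ring

/-- Here `g' = g (L - 2)` at `log L`, so `2 < L` makes the division by `g'` legitimate. -/
theorem invB₂_model {L : ℝ} (hL : 2 < L) : invB₂ (modelNonlinearity 1) (log L) =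
    (-log (modelTail L) / L) * (-log (modelTail L) / L) * ((1 + 1 / L) * (1 + 4 / L)) := by
  have hL0 : 0 < L := by linarith
  have h := modelNonlinearity_mul_modelTail hL0
  have hL2 : L - 2 ≠ 0 := by linarith
  have hg : modelNonlinearity 1 (log L) ≠ 0 := by rw [modelNonlinearity_one_eq]; positivity
  rw [invB₂, tailIntegral_modelNonlinearity_one, deriv_deriv_modelNonlinearity_one,
    deriv_modelNonlinearity_one, exp_log hL0]
  have e : modelNonlinearity 1 (log L) * (L - 2) * modelTail L = (L - 2) * ((L + 1) / L ^ 2) := by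
    rw [← h]; ring
  have e2 : modelNonlinearity 1 (log L) * (modelNonlinearity 1 (log L) * ((L - 2) ^ 2 + L)) *
      modelTail L / (modelNonlinearity 1 (log L) * (L - 2)) =
      ((L + 1) / L ^ 2) * ((L - 2) ^ 2 + L) / (L - 2) := by
    rw [← h]; field_simp
  beta_reduce
  rw [exp_log hL0, e, e2]
  field_simp
  ring

theorem tendsto_log_div_self : Tendsto (fun L : ℝ => log L / L) atTop (𝓝 0) := by
  simpa using tendsto_pow_log_div_mul_add_atTop 1 0 1 one_ne_zero

theorem isBigO_inv_log_div (c : ℝ) :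
    (fun L : ℝ => 1 + c / L - 1) =O[atTop] fun L => log L / L := by
  refine IsBigO.of_bound |c| ?_
  filter_upwards [eventually_ge_atTop (exp 1)] with L hL
  have hL0 : 0 < L := lt_of_lt_of_le (exp_pos 1) hL
  have hl : 1 ≤ log L := (le_log_iff_exp_le hL0).2 hL
  rw [norm_of_nonneg (r := log L / L) (by positivity), add_sub_cancel_left, norm_eq_abs, abs_div,
    abs_of_pos hL0, ← mul_div_assoc]
  gcongr
  exact le_mul_of_one_le_right (abs_nonneg c) hl

theorem isBigO_neg_log_modelTail :
    (fun L => -log (modelTail L) / L - 1) =O[atTop] fun L => log L / L := by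
  refine IsBigO.of_bound 4 ?_
  filter_upwards [eventually_ge_atTop (exp 1)] with L hL
  have hL0 : 0 < L := lt_of_lt_of_le (exp_pos 1) hL
  have hL1 : 1 ≤ L := (one_le_exp zero_le_one).trans hL
  have hl : 1 ≤ log L := (le_log_iff_exp_le hL0).2 hL
  have h1 : 0 ≤ log (L + 1) := log_nonneg (by linarith)
  have h2 : log (L + 1) ≤ log 2 + log L := by
    rw [← log_mul two_ne_zero hL0.ne']
    exact log_le_log (by linarith) (by linarith)
  have h4 : log 4 = 2 * log 2 := by
    rw [show (4 : ℝ) = 2 ^ 2 by norm_num, log_pow]; norm_num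
  have h5 := log_two_lt_d9
  have h6 := log_two_gt_d9
  have e : (L - log (L + 1) + log 4) / L - 1 = (log 4 - log (L + 1)) / L := by
    field_simp; ring
  rw [neg_log_modelTail hL0, e, norm_of_nonneg (r := log L / L) (by positivity), norm_eq_abs,
    abs_div, abs_of_pos hL0, ← mul_div_assoc]
  gcongr
  rw [abs_le]
  constructor <;> linarith

theorem isBigO_invB₁_model :
    (fun L => invB₁ (modelNonlinearity 1) (log L) - 1) =O[atTop] fun L => log L / L := by
  have h := (isBigO_mul_sub_mul isBigO_neg_log_modelTail (isBigO_inv_log_div 2) (isBigO_refl _ _)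
    (isBigO_refl _ _) (tendsto_log_div_self.isBigO_one ℝ)).1
  refine h.congr' ?_ EventuallyEq.rfl
  filter_upwards [eventually_gt_atTop 0] with L hL
  rw [invB₁_model hL, mul_one]

theorem isBigO_invB₂_model :
    (fun L => invB₂ (modelNonlinearity 1) (log L) - 1) =O[atTop] fun L => log L / L := by
  have he := tendsto_log_div_self.isBigO_one ℝ
  have h1 := isBigO_mul_sub_mul isBigO_neg_log_modelTail isBigO_neg_log_modelTail
    (isBigO_refl _ _) (isBigO_refl _ _) he
  have h2 := isBigO_mul_sub_mul (isBigO_inv_log_div 1) (isBigO_inv_log_div 4)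
    (isBigO_refl _ _) (isBigO_refl _ _) he
  have h := (isBigO_mul_sub_mul h1.1 h2.1 h1.2 h2.2 he).1
  refine h.congr' ?_ EventuallyEq.rfl
  filter_upwards [eventually_gt_atTop 2] with L hL
  rw [invB₂_model hL]
  norm_num

end Model

/-! ### The discrepancy condition as a limit in `L`. -/

section Discrepancy

variable {q : ℝ}

/-- The approximate solution in terms of `L = log (1 / ‖x‖ ^ 2)`. -/
noncomputable def approxProfile (q L : ℝ) : ℝ := tailInverse (doubleExp q) (modelTail L)

theorem tendsto_modelTail_nhdsGT : Tendsto modelTail atTop (𝓝[>] 0) := by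
  refine tendsto_nhdsWithin_iff.2 ⟨tendsto_modelTail, ?_⟩
  filter_upwards [eventually_gt_atTop 0] with L hL using modelTail_pos hL

theorem tendsto_approxProfile (hq : 1 ≤ q) : Tendsto (approxProfile q) atTop atTop :=
  (tendsto_tailInverse_doubleExp hq).comp tendsto_modelTail_nhdsGT

/-- `-log F(ũ) = -log G(v)`, where the left side is asymptotic to `exp (ũ ^ q)` and the right side
to `L`. -/
theorem tendsto_exp_approxProfile_div (hq : 1 ≤ q) :
    Tendsto (fun L => exp (approxProfile q L ^ q) / L) atTop (𝓝 1) := by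
  have h1 : Tendsto (fun L => -log (modelTail L) / L) atTop (𝓝 1) := by
    simpa using (isBigO_neg_log_modelTail.trans_tendsto tendsto_log_div_self).add_const 1
  have h2 : Tendsto (fun s => -log (tailIntegral (doubleExp q) s) / exp (s ^ q)) atTop (𝓝 1) := by
    simpa using ((isBigO_neg_log_tailIntegral hq).trans_tendsto
      (tendsto_rpow_div_exp_rpow hq)).add_const 1
  have h3 := h1.div (h2.comp (tendsto_approxProfile hq)) one_ne_zero
  rw [div_one] at h3
  refine h3.congr' ?_
  filter_upwards [tendsto_modelTail_nhdsGT.eventually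
    (Ioo_mem_nhdsGT (tailIntegral_doubleExp_pos hq one_pos)),
    h1.eventually (lt_mem_nhds one_pos), eventually_gt_atTop 0] with L hw hpos hL
  obtain ⟨-, h5⟩ := tailInverse_doubleExp_spec hq hw.1 hw.2.le
  rw [Pi.div_apply, Function.comp, approxProfile, h5]
  have h6 : -log (modelTail L) ≠ 0 := by
    intro h; rw [h, zero_div] at hpos; exact lt_irrefl _ hpos
  have := exp_pos (tailInverse (doubleExp q) (modelTail L) ^ q)
  have h7 : log (modelTail L) ≠ 0 := neg_ne_zero.1 h6
  field_simp

theorem tendsto_sqrt_mul_log_div : Tendsto (fun t : ℝ => √t * (log t / t)) atTop (𝓝 0) := by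
  have h := (isLittleO_log_rpow_atTop (r := 1 / 2) (by norm_num)).tendsto_div_nhds_zero
  refine h.congr' ?_
  filter_upwards [eventually_gt_atTop 0] with t ht
  rw [← sqrt_eq_rpow]
  have := sqrt_pos.2 ht
  have h2 := mul_self_sqrt ht.le
  field_simp
  rw [sq, h2]

theorem tendsto_sqrt_div_log : Tendsto (fun t : ℝ => √t / log t) atTop atTop := by
  have h := (isLittleO_log_rpow_atTop (r := 1 / 2) (by norm_num)).tendsto_div_nhds_zero
  have h2 : Tendsto (fun t : ℝ => log t / t ^ (1 / 2 : ℝ)) atTop (𝓝[>] 0) := by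
    refine tendsto_nhdsWithin_iff.2 ⟨h, ?_⟩
    filter_upwards [eventually_gt_atTop 1] with t ht
    exact div_pos (log_pos ht) (rpow_pos_of_pos (by linarith) _)
  refine h2.inv_tendsto_nhdsGT_zero.congr fun t => ?_
  rw [Pi.inv_apply, inv_div, sqrt_eq_rpow]

theorem tendsto_sqrt_div_exp_approxProfile (hq : 1 ≤ q) :
    Tendsto (fun L => √L / √(exp (approxProfile q L ^ q))) atTop (𝓝 1) := by
  have h := ((tendsto_exp_approxProfile_div hq).inv₀ one_ne_zero).sqrt
  rw [inv_one, sqrt_one] at h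
  refine h.congr fun L => ?_
  rw [inv_div, sqrt_div' _ (exp_pos _).le]

theorem tendsto_sqrt_mul_error (hq : 1 ≤ q) :
    Tendsto (fun L => √L * (approxProfile q L ^ q / exp (approxProfile q L ^ q)))
      atTop (𝓝 0) := by
  have h := (tendsto_sqrt_div_exp_approxProfile hq).mul (tendsto_sqrt_mul_log_div.comp
    ((tendsto_exp_rpow hq).comp (tendsto_approxProfile hq)))
  rw [mul_zero] at h
  refine h.congr fun L => ?_
  have := sqrt_pos.2 (exp_pos (approxProfile q L ^ q))
  simp only [Function.comp, log_exp]
  field_simp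

theorem tendsto_sqrt_div_approxProfile (hq : 1 ≤ q) :
    Tendsto (fun L => √L / approxProfile q L ^ q) atTop atTop := by
  have h := (tendsto_sqrt_div_exp_approxProfile hq).pos_mul_atTop one_pos
    (tendsto_sqrt_div_log.comp ((tendsto_exp_rpow hq).comp (tendsto_approxProfile hq)))
  refine h.congr fun L => ?_
  have := sqrt_pos.2 (exp_pos (approxProfile q L ^ q))
  simp only [Function.comp, log_exp]
  field_simp

theorem tendsto_sqrt_mul_of_isBigO {X e : ℝ → ℝ} (hX : X =O[atTop] e)
    (he : Tendsto (fun L => √L * e L) atTop (𝓝 0)) :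
    Tendsto (fun L => √L * X L) atTop (𝓝 0) :=
  ((isBigO_refl (fun L : ℝ => √L) atTop).mul hX).trans_tendsto he

theorem tendsto_log_one_div_sq :
    Tendsto (fun x : Plane => log (1 / ‖x‖ ^ 2)) (𝓝[≠] 0) atTop := by
  have h : Tendsto (fun x : Plane => ‖x‖) (𝓝[≠] 0) (𝓝[>] 0) := tendsto_norm_nhdsNE_zero
  have h1 := (tendsto_log_nhdsGT_zero.comp h).const_mul_atBot_of_neg (show (-2 : ℝ) < 0 by norm_num)
  refine h1.congr fun x => ?_
  simp only [Function.comp]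
  rw [one_div, log_inv, log_pow]
  push_cast; ring

theorem neg_log_norm_rpow_half (x : Plane) :
    (-log ‖x‖) ^ (1 / 2 : ℝ) = (√2)⁻¹ * √(log (1 / ‖x‖ ^ 2)) := by
  have e : log (1 / ‖x‖ ^ 2) = 2 * -log ‖x‖ := by
    rw [one_div, log_inv, log_pow]; push_cast; ring
  rw [← sqrt_eq_rpow, e, sqrt_mul zero_le_two]
  have : 0 < √2 := by positivity
  field_simp

theorem R_eq_of_pos (q : ℝ) {x : Plane} (hx : 0 < log (1 / ‖x‖ ^ 2)) :
    R₁ (doubleExp q) 1 x = |invB₁ (doubleExp q) (approxProfile q (log (1 / ‖x‖ ^ 2))) -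
      invB₁ (modelNonlinearity 1) (log (log (1 / ‖x‖ ^ 2)))| ∧
    R₂ (doubleExp q) 1 x = |invB₂ (doubleExp q) (approxProfile q (log (1 / ‖x‖ ^ 2))) -
      invB₂ (modelNonlinearity 1) (log (log (1 / ‖x‖ ^ 2)))| := by
  have h1 : modelSolution 1 x = log (log (1 / ‖x‖ ^ 2)) := by rw [modelSolution, if_pos rfl]
  rw [R₁, R₂, approxSolution, h1, tailIntegral_modelNonlinearity_one, exp_log hx, approxProfile]
  exact ⟨rfl, rfl⟩

/-- At `q = 1` the coefficient `1 - 1 / q` vanishes, leaving errors `O(log L / L) = o(L ^ (-1/2))`.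
-/
theorem discrepancyCondition_doubleExp_one : DiscrepancyCondition (doubleExp 1) 1 := by
  have hE := tendsto_sqrt_mul_error (le_refl (1 : ℝ))
  have hU := tendsto_approxProfile (le_refl (1 : ℝ))
  have hf1 := tendsto_sqrt_mul_of_isBigO ((isBigO_invB₁_doubleExp le_rfl).comp_tendsto hU) hE
  have hf2 := tendsto_sqrt_mul_of_isBigO ((isBigO_invB₂_doubleExp le_rfl).comp_tendsto hU) hE
  have hg1 := tendsto_sqrt_mul_of_isBigO isBigO_invB₁_model tendsto_sqrt_mul_log_div
  have hg2 := tendsto_sqrt_mul_of_isBigO isBigO_invB₂_model tendsto_sqrt_mul_log_div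
  have h := (((hf1.sub hg1).abs.add (hf2.sub hg2).abs).const_mul (√2)⁻¹).comp tendsto_log_one_div_sq
  simp only [sub_zero, abs_zero, add_zero, mul_zero] at h
  refine h.congr' ?_
  filter_upwards [tendsto_log_one_div_sq.eventually_gt_atTop 0] with x hx
  obtain ⟨e1, e2⟩ := R_eq_of_pos 1 hx
  rw [e1, e2, neg_log_norm_rpow_half]
  simp only [Function.comp]
  generalize log (1 / ‖x‖ ^ 2) = L at *
  have hs : 0 ≤ √L := sqrt_nonneg L
  rw [← mul_sub, ← mul_sub, abs_mul, abs_mul, abs_of_nonneg hs]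
  norm_num
  ring

/-- `R₁` alone already diverges after weighting: the term `(1 - 1 / q) √L / ũ ^ q` is not
compensated by the model. -/
theorem not_discrepancyCondition_doubleExp (hq : 1 < q) :
    ¬ DiscrepancyCondition (doubleExp q) 1 := by
  intro hD
  have hE := tendsto_sqrt_mul_error hq.le
  have hU := tendsto_approxProfile hq.le
  have hf1 := tendsto_sqrt_mul_of_isBigO ((isBigO_invB₁_doubleExp hq.le).comp_tendsto hU) hE
  have hg1 := tendsto_sqrt_mul_of_isBigO isBigO_invB₁_model tendsto_sqrt_mul_log_div
  have ha : 0 < 1 - 1 / q := by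
    have : 1 / q < 1 := (div_lt_one (by linarith)).2 hq
    linarith
  have h := (((hf1.sub hg1).add_atTop ((tendsto_sqrt_div_approxProfile hq.le).const_mul_atTop
    ha)).const_mul_atTop (show 0 < (√2)⁻¹ by positivity)).comp tendsto_log_one_div_sq
  refine not_tendsto_nhds_of_tendsto_atTop (tendsto_atTop_mono' _ ?_ h) 0 hD
  filter_upwards [tendsto_log_one_div_sq.eventually_gt_atTop 0] with x hx
  obtain ⟨e1, e2⟩ := R_eq_of_pos q hx
  rw [e1, e2, neg_log_norm_rpow_half]
  simp only [Function.comp]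
  generalize log (1 / ‖x‖ ^ 2) = L at *
  rw [mul_assoc]
  refine mul_le_mul_of_nonneg_left ?_ (by positivity)
  have e : ∀ A B C U : ℝ, √L * (A - (1 + C / U)) - √L * (B - 1) + C * (√L / U) = √L * (A - B) := by
    intros; ring
  rw [e]
  refine mul_le_mul_of_nonneg_left ?_ (sqrt_nonneg L)
  exact (le_abs_self _).trans (le_add_of_nonneg_right (abs_nonneg _))

end Discrepancy

/-! ### Radial Laplacian and reduction to an ordinary differential equation. -/

section Radial

variable {E : Type*} [NormedAddCommGroup E] [InnerProductSpace ℝ E]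

theorem hasFDerivAt_comp_norm_sq {h : ℝ → ℝ} {h' : ℝ} {z : E} (hh : HasDerivAt h h' (‖z‖ ^ 2)) :
    HasFDerivAt (fun z : E => h (‖z‖ ^ 2)) ((2 * h') • innerSL ℝ z) z := by
  have h1 := hh.comp_hasFDerivAt z (hasStrictFDerivAt_norm_sq z).hasFDerivAt
  refine h1.congr_fderiv ?_
  ext v
  simp only [_root_.smul_apply, smul_eq_mul, innerSL_apply_apply, nsmul_eq_mul]
  push_cast
  ring

/-- The Laplacian of a radial function. -/
theorem laplacian_comp_norm_sq [FiniteDimensional ℝ E] {h h' : ℝ → ℝ} {h'' : ℝ} {x : E}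
    (hh : ∀ᶠ ρ in 𝓝 (‖x‖ ^ 2), HasDerivAt h (h' ρ) ρ) (hh' : HasDerivAt h' h'' (‖x‖ ^ 2)) :
    Laplacian.laplacian (fun z : E => h (‖z‖ ^ 2)) x =
      2 * Module.finrank ℝ E * h' (‖x‖ ^ 2) + 4 * ‖x‖ ^ 2 * h'' := by
  have hn : Tendsto (fun z : E => ‖z‖ ^ 2) (𝓝 x) (𝓝 (‖x‖ ^ 2)) :=
    (continuous_norm.pow 2).tendsto x
  have h1 : fderiv ℝ (fun z : E => h (‖z‖ ^ 2)) =ᶠ[𝓝 x]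
      fun z => (2 * h' (‖z‖ ^ 2)) • innerSL ℝ z := by
    filter_upwards [hn.eventually hh] with z hz using (hasFDerivAt_comp_norm_sq hz).fderiv
  have h2 := ((hasFDerivAt_comp_norm_sq hh').const_mul (2 : ℝ)).smul
    (innerSL ℝ (E := E)).hasFDerivAt
  have h3 := (h2.congr_of_eventuallyEq h1).fderiv
  rw [InnerProductSpace.laplacian_eq_iteratedFDeriv_stdOrthonormalBasis]
  simp only [iteratedFDeriv_two_apply, Matrix.cons_val_zero, Matrix.cons_val_one]
  rw [h3]
  simp only [_root_.add_apply, _root_.smul_apply, ContinuousLinearMap.smulRight_apply, innerSL_apply_apply, smul_eq_mul]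
  have e : ∀ i, 2 * h' (‖x‖ ^ 2) * inner ℝ (stdOrthonormalBasis ℝ E i) (stdOrthonormalBasis ℝ E i) +
      2 * (2 * h'' * inner ℝ x (stdOrthonormalBasis ℝ E i)) *
        inner ℝ x (stdOrthonormalBasis ℝ E i) = 2 * h' (‖x‖ ^ 2) +
      4 * h'' * ‖inner ℝ x (stdOrthonormalBasis ℝ E i)‖ ^ 2 := by
    intro i
    rw [real_inner_self_eq_norm_sq, (stdOrthonormalBasis ℝ E).norm_eq_one, norm_eq_abs, sq_abs]
    ring
  -- Parseval turns the sum of the radial second-derivative terms into `‖x‖ ^ 2`.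
  have hp := (stdOrthonormalBasis ℝ E).sum_sq_norm_inner_left x
  refine (Finset.sum_congr rfl fun i _ => e i).trans ?_
  rw [Finset.sum_add_distrib, ← Finset.mul_sum, ← Finset.mul_sum, hp,
    Finset.sum_const, Finset.card_univ, Fintype.card_fin, nsmul_eq_mul]
  ring

/-- A profile `y(L)`, `L = log (1 / ‖x‖ ^ 2)`, with `y'' = -exp (-L + exp y) / 4` yields a singular
solution of `-Δ u = exp (exp u)`. -/
theorem isSmoothSingularSolution_of_profile {y y' : ℝ → ℝ} {L₀ : ℝ}
    (hy : ContDiffOn ℝ ∞ y (Ioi L₀)) (hpos : ∀ L, L₀ < L → 0 ≤ y L)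
    (hd : ∀ L, L₀ < L → HasDerivAt y (y' L) L)
    (hd' : ∀ L, L₀ < L → HasDerivAt y' (-(1 / 4 * exp (-L + exp (y L)))) L)
    (hlim : Tendsto y atTop atTop) :
    IsSmoothSingularSolution (doubleExp 1) (exp (-L₀ / 2))
      (fun x => y (log (1 / ‖x‖ ^ 2))) := by
  have key : ∀ x ∈ Metric.ball (0 : Plane) (exp (-L₀ / 2)) \ {0},
      0 < ‖x‖ ∧ L₀ < log (1 / ‖x‖ ^ 2) := by
    rintro x ⟨hx, hx0⟩
    have h0 : 0 < ‖x‖ := norm_pos_iff.2 hx0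
    rw [mem_ball_zero_iff] at hx
    have := (log_lt_iff_lt_exp h0).2 hx
    refine ⟨h0, ?_⟩
    rw [one_div, log_inv, log_pow]
    push_cast
    linarith
  refine ⟨?_, fun x hx => hpos _ (key x hx).2, fun x _ z _ hxz => by simp only [hxz], ?_,
    hlim.comp tendsto_log_one_div_sq⟩
  · have h1 : ContDiffOn ℝ ∞ (fun x : Plane => log (1 / ‖x‖ ^ 2))
        (Metric.ball 0 (exp (-L₀ / 2)) \ {0}) := by
      intro x hx
      have h0 := (key x hx).1
      refine (ContDiffAt.log ?_ (by positivity)).contDiffWithinAt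
      exact contDiffAt_const.div (contDiff_norm_sq ℝ).contDiffAt (by positivity)
    exact hy.comp h1 fun x hx => (key x hx).2
  · intro x hx
    obtain ⟨h0, hL⟩ := key x hx
    have hl : ∀ ρ : ℝ, 0 < ρ → HasDerivAt (fun ρ => log (1 / ρ)) (-ρ⁻¹) ρ := by
      intro ρ hρ
      simp only [one_div, log_inv]
      exact (hasDerivAt_log hρ.ne').neg
    have hc : ContinuousAt (fun ρ : ℝ => log (1 / ρ)) (‖x‖ ^ 2) :=
      (hl _ (by positivity)).continuousAt
    have e1 : ∀ᶠ ρ in 𝓝 (‖x‖ ^ 2),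
        HasDerivAt (fun ρ => y (log (1 / ρ))) (y' (log (1 / ρ)) * -ρ⁻¹) ρ := by
      filter_upwards [hc.eventually (lt_mem_nhds hL), lt_mem_nhds (pow_pos h0 2)] with ρ h1 h2
      exact (hd _ h1).comp ρ (hl ρ h2)
    have e2 := ((hd' _ hL).comp (‖x‖ ^ 2) (hl _ (by positivity))).mul
      (hasDerivAt_inv (pow_pos h0 2).ne').neg
    -- In dimension two the terms with `y'` cancel: `Δ u = 4 y'' / ‖x‖ ^ 2 = 4 exp L * y''`.
    have e3 := laplacian_comp_norm_sq e1 e2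
    rw [e3, doubleExp, rpow_one, finrank_euclideanSpace_fin]
    simp only [Function.comp, Pi.neg_apply]
    rw [exp_add, exp_neg (log _), exp_log (by positivity)]
    field_simp
    push_cast
    ring

end Radial

/-! ### The model oscillator, variation of constants from infinity, and the fixed point. -/

section Oscillator

/-- `L ^ (1/4) cos (2 √L)`, a solution of `y'' + (1 / L + 3 / (16 L ^ 2)) y = 0`. -/
noncomputable def oscCos (L : ℝ) : ℝ := √√L * cos (2 * √L)

/-- `L ^ (1/4) sin (2 √L)`, a solution of `y'' + (1 / L + 3 / (16 L ^ 2)) y = 0`. -/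
noncomputable def oscSin (L : ℝ) : ℝ := √√L * sin (2 * √L)

/-- The derivative of `oscCos`. -/
noncomputable def oscCosD (L : ℝ) : ℝ := √√L * (cos (2 * √L) / (4 * L) - sin (2 * √L) / √L)

/-- The derivative of `oscSin`. -/
noncomputable def oscSinD (L : ℝ) : ℝ := √√L * (sin (2 * √L) / (4 * L) + cos (2 * √L) / √L)

variable {L : ℝ}

theorem hasDerivAt_sqrt_sqrt (hL : 0 < L) : HasDerivAt (fun y => √√y) (√√L / (4 * L)) L := by
  have h1 := sqrt_pos.2 hL
  have h2 := sqrt_pos.2 h1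
  refine ((hasDerivAt_sqrt h1.ne').comp L (hasDerivAt_sqrt hL.ne')).congr_deriv ?_
  have e1 := mul_self_sqrt hL.le
  have e2 := mul_self_sqrt h1.le
  have e3 : L = √√L * √√L * (√√L * √√L) := by rw [e2, e1]
  have e4 : √L = √√L * √√L := e2.symm
  generalize √√L = r at *
  rw [e4, e3]
  field_simp
  norm_num

theorem hasDerivAt_two_sqrt (hL : 0 < L) : HasDerivAt (fun y => 2 * √y) (1 / √L) L := by
  refine ((hasDerivAt_sqrt hL.ne').const_mul 2).congr_deriv ?_
  have h1 := sqrt_pos.2 hL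
  field_simp

theorem hasDerivAt_inv_sqrt (hL : 0 < L) : HasDerivAt (fun y => (√y)⁻¹) (-(1 / (2 * L * √L))) L := by
  have h1 := sqrt_pos.2 hL
  refine ((hasDerivAt_sqrt hL.ne').inv h1.ne').congr_deriv ?_
  have := sq_sqrt hL.le
  rw [this]
  field_simp

theorem hasDerivAt_oscCos (hL : 0 < L) : HasDerivAt oscCos (oscCosD L) L := by
  refine ((hasDerivAt_sqrt_sqrt hL).mul (hasDerivAt_two_sqrt hL).cos).congr_deriv ?_
  rw [oscCosD]; ring

theorem hasDerivAt_oscSin (hL : 0 < L) : HasDerivAt oscSin (oscSinD L) L := by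
  refine ((hasDerivAt_sqrt_sqrt hL).mul (hasDerivAt_two_sqrt hL).sin).congr_deriv ?_
  rw [oscSinD]; ring

/-- Liouville form: amplitude `A = L ^ (1/4)` and phase `φ = 2 √L` satisfy `A ^ 2 φ' = 1`, so `(A
cos φ)'' = (A'' / A - φ' ^ 2) A cos φ`, and `A'' / A = -3 / (16 L ^ 2)`. -/
theorem hasDerivAt_oscCosD (hL : 0 < L) :
    HasDerivAt oscCosD (-(1 / L + 3 / (16 * L ^ 2)) * oscCos L) L := by
  have h1 := sqrt_pos.2 hL
  have hi : HasDerivAt (fun y : ℝ => (4 * y)⁻¹) (-(1 / (4 * L ^ 2))) L := by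
    refine (((hasDerivAt_id L).const_mul 4).inv (by simp [hL.ne'])).congr_deriv ?_
    simp only [id]; field_simp
  refine ((hasDerivAt_sqrt_sqrt hL).mul (((hasDerivAt_two_sqrt hL).cos.mul hi).sub
    ((hasDerivAt_two_sqrt hL).sin.mul (hasDerivAt_inv_sqrt hL)))).congr_deriv ?_
  simp only [Pi.sub_apply, Pi.mul_apply, oscCos]
  have e : L = √L * √L := (mul_self_sqrt hL.le).symm
  generalize √√L = r at *
  generalize √L = w at *
  subst e
  field_simp
  ring

theorem hasDerivAt_oscSinD (hL : 0 < L) :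
    HasDerivAt oscSinD (-(1 / L + 3 / (16 * L ^ 2)) * oscSin L) L := by
  have h1 := sqrt_pos.2 hL
  have hi : HasDerivAt (fun y : ℝ => (4 * y)⁻¹) (-(1 / (4 * L ^ 2))) L := by
    refine (((hasDerivAt_id L).const_mul 4).inv (by simp [hL.ne'])).congr_deriv ?_
    simp only [id]; field_simp
  refine ((hasDerivAt_sqrt_sqrt hL).mul (((hasDerivAt_two_sqrt hL).sin.mul hi).add
    ((hasDerivAt_two_sqrt hL).cos.mul (hasDerivAt_inv_sqrt hL)))).congr_deriv ?_
  simp only [Pi.add_apply, Pi.mul_apply, oscSin]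
  have e : L = √L * √L := (mul_self_sqrt hL.le).symm
  generalize √√L = r at *
  generalize √L = w at *
  subst e
  field_simp
  ring

theorem osc_wronskian (hL : 0 < L) : oscCos L * oscSinD L - oscSin L * oscCosD L = 1 := by
  have h1 := sqrt_pos.2 hL
  have e : √√L * √√L = √L := mul_self_sqrt h1.le
  have h2 := sin_sq_add_cos_sq (2 * √L)
  calc _ = √√L * √√L / √L * (sin (2 * √L) ^ 2 + cos (2 * √L) ^ 2) := by
        rw [oscCos, oscSinD, oscSin, oscCosD]; ring
    _ = 1 := by rw [e, h2, div_self h1.ne', one_mul]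

theorem sqrt_sqrt_eq_rpow (hL : 0 ≤ L) : √√L = L ^ (1 / 4 : ℝ) := by
  rw [sqrt_eq_rpow, sqrt_eq_rpow, ← rpow_mul hL]; norm_num

theorem abs_oscCos_le (hL : 0 ≤ L) : |oscCos L| ≤ L ^ (1 / 4 : ℝ) := by
  rw [oscCos, abs_mul, abs_of_nonneg (sqrt_nonneg _), ← sqrt_sqrt_eq_rpow hL]
  exact mul_le_of_le_one_right (sqrt_nonneg _) (abs_cos_le_one _)

theorem abs_oscSin_le (hL : 0 ≤ L) : |oscSin L| ≤ L ^ (1 / 4 : ℝ) := by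
  rw [oscSin, abs_mul, abs_of_nonneg (sqrt_nonneg _), ← sqrt_sqrt_eq_rpow hL]
  exact mul_le_of_le_one_right (sqrt_nonneg _) (abs_sin_le_one _)

theorem continuous_oscCos : Continuous oscCos := by unfold oscCos; fun_prop

theorem continuous_oscSin : Continuous oscSin := by unfold oscSin; fun_prop

/-- `n` is continuous on `(a, ∞)` and bounded there by `K s ^ (-7/2)`. -/
structure Decays (a K : ℝ) (n : ℝ → ℝ) : Prop where
  continuousOn : ContinuousOn n (Ioi a)
  abs_le : ∀ s, a < s → |n s| ≤ K * s ^ (-7 / 2 : ℝ)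

variable {a K : ℝ} {n p : ℝ → ℝ}

theorem Decays.norm_mul_le (hn : Decays a K n) (ha : 0 ≤ a)
    (hp : ∀ s, 0 ≤ s → |p s| ≤ s ^ (1 / 4 : ℝ)) {s : ℝ} (hs : a < s) :
    ‖p s * n s‖ ≤ K * s ^ (-13 / 4 : ℝ) := by
  have hs0 : 0 < s := lt_of_le_of_lt ha hs
  rw [norm_mul, norm_eq_abs, norm_eq_abs]
  calc _ ≤ s ^ (1 / 4 : ℝ) * (K * s ^ (-7 / 2 : ℝ)) :=
        mul_le_mul (hp s hs0.le) (hn.abs_le s hs) (abs_nonneg _) (rpow_nonneg hs0.le _)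
    _ = K * (s ^ (1 / 4 : ℝ) * s ^ (-7 / 2 : ℝ)) := by ring
    _ = _ := by rw [← rpow_add hs0]; norm_num

theorem Decays.integrableOn (hn : Decays a K n) (ha : 0 ≤ a) (hpc : Continuous p)
    (hp : ∀ s, 0 ≤ s → |p s| ≤ s ^ (1 / 4 : ℝ)) (hL : a < L) :
    MeasureTheory.IntegrableOn (fun s => p s * n s) (Ioi L) := by
  have hL0 : 0 < L := lt_of_le_of_lt ha hL
  refine MeasureTheory.Integrable.mono'
    ((integrableOn_Ioi_rpow_of_lt (a := -13 / 4) (by norm_num) hL0).const_mul K) ?_ ?_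
  · exact ((hpc.continuousOn.mul hn.continuousOn).mono
      (Ioi_subset_Ioi hL.le)).aestronglyMeasurable measurableSet_Ioi
  · refine (MeasureTheory.ae_restrict_iff' measurableSet_Ioi).2 (Eventually.of_forall ?_)
    exact fun s hs => hn.norm_mul_le ha hp (hL.trans hs)

theorem Decays.abs_integral_le (hn : Decays a K n) (ha : 0 ≤ a)
    (hp : ∀ s, 0 ≤ s → |p s| ≤ s ^ (1 / 4 : ℝ)) (hL : a < L) :
    |∫ s in Ioi L, p s * n s| ≤ 4 / 9 * K * L ^ (-9 / 4 : ℝ) := by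
  have hL0 : 0 < L := lt_of_le_of_lt ha hL
  have h1 := MeasureTheory.norm_integral_le_of_norm_le
    ((integrableOn_Ioi_rpow_of_lt (a := -13 / 4) (by norm_num) hL0).const_mul K)
    ((MeasureTheory.ae_restrict_iff' measurableSet_Ioi).2 (Eventually.of_forall
      fun s (hs : L < s) => hn.norm_mul_le ha hp (hL.trans hs)))
  rw [MeasureTheory.integral_const_mul, integral_Ioi_rpow_of_lt (by norm_num) hL0] at h1
  refine h1.trans (le_of_eq ?_)
  norm_num
  ring

/-- The solution of `θ'' + (1 / L + 3 / (16 L ^ 2)) θ = n` that is small at infinity. -/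
noncomputable def oscSolve (n : ℝ → ℝ) (L : ℝ) : ℝ :=
  oscCos L * (∫ s in Ioi L, oscSin s * n s) - oscSin L * ∫ s in Ioi L, oscCos s * n s

/-- The derivative of `oscSolve n`. -/
noncomputable def oscSolveD (n : ℝ → ℝ) (L : ℝ) : ℝ :=
  oscCosD L * (∫ s in Ioi L, oscSin s * n s) - oscSinD L * ∫ s in Ioi L, oscCos s * n s

theorem Decays.hasDerivAt_integral (hn : Decays a K n) (ha : 0 ≤ a) (hpc : Continuous p)
    (hp : ∀ s, 0 ≤ s → |p s| ≤ s ^ (1 / 4 : ℝ)) (hL : a < L) :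
    HasDerivAt (fun y => ∫ s in Ioi y, p s * n s) (-(p L * n L)) L := by
  obtain ⟨b, hab, hbL⟩ := exists_between hL
  exact hasDerivAt_integral_Ioi (hn.integrableOn ha hpc hp hab)
    ((hpc.continuousOn.mul hn.continuousOn).mono (Ioi_subset_Ioi hab.le)) hbL

theorem Decays.hasDerivAt_oscSolve (hn : Decays a K n) (ha : 0 ≤ a) (hL : a < L) :
    HasDerivAt (oscSolve n) (oscSolveD n L) L := by
  have hL0 : 0 < L := lt_of_le_of_lt ha hL
  have hA := hn.hasDerivAt_integral ha continuous_oscSin (fun _ => abs_oscSin_le) hL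
  have hB := hn.hasDerivAt_integral ha continuous_oscCos (fun _ => abs_oscCos_le) hL
  refine (((hasDerivAt_oscCos hL0).mul hA).sub ((hasDerivAt_oscSin hL0).mul hB)).congr_deriv ?_
  rw [oscSolveD]; ring

theorem Decays.hasDerivAt_oscSolveD (hn : Decays a K n) (ha : 0 ≤ a) (hL : a < L) :
    HasDerivAt (oscSolveD n) (n L - (1 / L + 3 / (16 * L ^ 2)) * oscSolve n L) L := by
  have hL0 : 0 < L := lt_of_le_of_lt ha hL
  have hA := hn.hasDerivAt_integral ha continuous_oscSin (fun _ => abs_oscSin_le) hL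
  have hB := hn.hasDerivAt_integral ha continuous_oscCos (fun _ => abs_oscCos_le) hL
  refine (((hasDerivAt_oscCosD hL0).mul hA).sub ((hasDerivAt_oscSinD hL0).mul hB)).congr_deriv ?_
  have hw := osc_wronskian hL0
  rw [oscSolve]
  linear_combination n L * hw

/-- Each integrand is at most `K s ^ (1/4 - 7/2)`; integrating gives `4/9 K L ^ (-9/4)`, the outer
factor `L ^ (1/4)` brings this to `L⁻²`, and there are two such terms. -/
theorem Decays.abs_oscSolve_le (hn : Decays a K n) (ha : 0 ≤ a) (hL : a < L) :
    L ^ 2 * |oscSolve n L| ≤ 8 / 9 * K := by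
  have hL0 : 0 < L := lt_of_le_of_lt ha hL
  have hA := hn.abs_integral_le ha (fun _ => abs_oscSin_le) hL
  have hB := hn.abs_integral_le ha (fun _ => abs_oscCos_le) hL
  have hc := abs_oscCos_le hL0.le
  have hs := abs_oscSin_le hL0.le
  have hr := rpow_nonneg hL0.le (1 / 4)
  have e : L ^ (1 / 4 : ℝ) * (4 / 9 * K * L ^ (-9 / 4 : ℝ)) = 4 / 9 * K * L ^ (-2 : ℝ) := by
    rw [show (-2 : ℝ) = 1 / 4 + -9 / 4 by norm_num, rpow_add hL0]; ring
  have h1 : |oscSolve n L| ≤ 8 / 9 * K * L ^ (-2 : ℝ) := by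
    rw [oscSolve]
    refine (abs_sub _ _).trans ?_
    rw [abs_mul, abs_mul]
    have k1 := mul_le_mul hc hA (abs_nonneg _) hr
    have k2 := mul_le_mul hs hB (abs_nonneg _) hr
    rw [e] at k1 k2
    linarith
  have e2 : L ^ (-2 : ℝ) = (L ^ 2)⁻¹ := by
    rw [rpow_neg hL0.le]; norm_num
  rw [e2] at h1
  calc L ^ 2 * |oscSolve n L| ≤ L ^ 2 * (8 / 9 * K * (L ^ 2)⁻¹) := by gcongr
    _ = _ := by field_simp

theorem Decays.oscSolve_sub {K' : ℝ} {n' : ℝ → ℝ} (hn : Decays a K n) (hn' : Decays a K' n')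
    (ha : 0 ≤ a) (hL : a < L) :
    oscSolve (fun s => n s - n' s) L = oscSolve n L - oscSolve n' L := by
  have h1 := MeasureTheory.integral_sub
    (hn.integrableOn ha continuous_oscSin (fun _ => abs_oscSin_le) hL)
    (hn'.integrableOn ha continuous_oscSin (fun _ => abs_oscSin_le) hL)
  have h2 := MeasureTheory.integral_sub
    (hn.integrableOn ha continuous_oscCos (fun _ => abs_oscCos_le) hL)
    (hn'.integrableOn ha continuous_oscCos (fun _ => abs_oscCos_le) hL)
  simp only [oscSolve, mul_sub, h1, h2]
  ring

open BoundedContinuousFunction in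
/-- Solutions at infinity of a weakly nonlinear perturbation of the oscillator. -/
theorem exists_perturbed_oscillator {a : ℝ} (ha : 0 ≤ a) {M : ℝ → ℝ → ℝ}
    (hc : ContinuousOn (Function.uncurry M) (Ioi a ×ˢ univ))
    (h0 : ∀ s, a < s → |M s 0| ≤ 1 / 4 * s ^ (-7 / 2 : ℝ))
    (hlip : ∀ s, a < s → ∀ c d, |M s c - M s d| ≤ 1 / 2 * |c - d| * s ^ (-7 / 2 : ℝ)) :
    ∃ θ θ' : ℝ → ℝ, ∀ L, a + 1 < L → |L ^ 2 * θ L| ≤ 1 ∧ HasDerivAt θ (θ' L) L ∧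
      HasDerivAt θ' (M L (L ^ 2 * θ L) - (1 / L + 3 / (16 * L ^ 2)) * θ L) L := by
  have hdec : ∀ z : ℝ →ᵇ ℝ, Decays a (1 / 4 + 1 / 2 * ‖z‖) (fun s => M s (z s)) := by
    intro z
    refine ⟨hc.comp (f := fun s => (s, z s)) (by fun_prop) fun s hs => ⟨hs, mem_univ _⟩, ?_⟩
    intro s hs
    have hs0 : 0 < s := lt_of_le_of_lt ha hs
    have h1 := hlip s hs (z s) 0
    have h2 := h0 s hs
    have h3 : |z s - 0| ≤ ‖z‖ := by simpa using z.norm_coe_le_norm s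
    have h4 := rpow_nonneg hs0.le (-7 / 2)
    have h5 : 1 / 2 * |z s - 0| * s ^ (-7 / 2 : ℝ) ≤ 1 / 2 * ‖z‖ * s ^ (-7 / 2 : ℝ) := by gcongr
    have h6 := abs_add_le (M s (z s) - M s 0) (M s 0)
    rw [sub_add_cancel] at h6
    linarith
  have hmax : ∀ L : ℝ, a < max L (a + 1) := fun L => lt_max_of_lt_right (by linarith)
  -- The unknown is `z = L ^ 2 θ`. Freezing the argument at `a + 1` gives a bounded continuous
  -- function on all of `ℝ` without affecting the equation for `L > a + 1`.
  let T : (ℝ →ᵇ ℝ) → (ℝ →ᵇ ℝ) := fun z =>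
    BoundedContinuousFunction.ofNormedAddCommGroup
      (fun L => (max L (a + 1)) ^ 2 * oscSolve (fun s => M s (z s)) (max L (a + 1)))
      (by
        have h1 : ContinuousOn (fun y => y ^ 2 * oscSolve (fun s => M s (z s)) y) (Ioi a) :=
          fun y hy => ((continuousAt_id.pow 2).mul
            ((hdec z).hasDerivAt_oscSolve ha hy).continuousAt).continuousWithinAt
        exact h1.comp_continuous (by fun_prop) hmax)
      (8 / 9 * (1 / 4 + 1 / 2 * ‖z‖))
      (fun L => by
        rw [norm_mul, norm_eq_abs, norm_eq_abs, abs_of_nonneg (sq_nonneg _)]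
        exact (hdec z).abs_oscSolve_le ha (hmax L))
  have hTapp : ∀ z L, T z L =
      (max L (a + 1)) ^ 2 * oscSolve (fun s => M s (z s)) (max L (a + 1)) := fun _ _ => rfl
  -- Solution bound `8/9` times Lipschitz constant `1/2`.
  have hT : ContractingWith (4 / 9) T := by
    refine ⟨by rw [div_lt_one (by norm_num)]; norm_num, LipschitzWith.of_dist_le_mul fun z w => ?_⟩
    refine (BoundedContinuousFunction.dist_le (by positivity)).2 fun L => ?_
    have hd : Decays a (1 / 2 * dist z w) (fun s => M s (z s) - M s (w s)) := by
      refine ⟨(hdec z).continuousOn.sub (hdec w).continuousOn, fun s hs => ?_⟩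
      have hs0 : 0 < s := lt_of_le_of_lt ha hs
      have h4 := rpow_nonneg hs0.le (-7 / 2)
      refine (hlip s hs _ _).trans ?_
      have h5 : |z s - w s| ≤ dist z w := dist_coe_le_dist (f := z) (g := w) s
      gcongr
    have h1 := hd.abs_oscSolve_le ha (hmax L)
    rw [(hdec z).oscSolve_sub (hdec w) ha (hmax L)] at h1
    rw [hTapp, hTapp, dist_eq, ← mul_sub, abs_mul, abs_of_nonneg (sq_nonneg _)]
    refine h1.trans (le_of_eq ?_)
    push_cast
    ring
  set z := ContractingWith.fixedPoint T hT with hz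
  have hfix : T z = z := hT.fixedPoint_isFixedPt
  -- The fixed point satisfies `‖z‖ ≤ 2/9 + 4/9 ‖z‖`.
  have hzn : ‖z‖ ≤ 1 := by
    have h1 : ‖T z‖ ≤ 8 / 9 * (1 / 4 + 1 / 2 * ‖z‖) :=
      BoundedContinuousFunction.norm_ofNormedAddCommGroup_le _ (by positivity) _
    rw [hfix] at h1
    linarith
  refine ⟨oscSolve (fun s => M s (z s)), oscSolveD (fun s => M s (z s)), fun L hL => ?_⟩
  have haL : a < L := by linarith
  have hzL : L ^ 2 * oscSolve (fun s => M s (z s)) L = z L := by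
    conv_rhs => rw [← hfix, hTapp, max_eq_left hL.le]
  refine ⟨?_, (hdec z).hasDerivAt_oscSolve ha haL, ?_⟩
  · rw [hzL]
    exact (z.norm_coe_le_norm L).trans hzn
  · rw [hzL]
    exact (hdec z).hasDerivAt_oscSolveD ha haL

end Oscillator

/-! ### The approximate profile: residual and linearization. -/

section Profile

/-- The second order correction in the expansion of `exp u`. -/
noncomputable def profCorr (L : ℝ) : ℝ := (4 * log L - 4 * log 2 - 6) / L

/-- An approximation of `exp u` for the singular solution `u`, where `L = log (1 / ‖x‖ ^ 2)`. -/
noncomputable def prof (L : ℝ) : ℝ := L - 2 * log L + 2 * log 2 + profCorr L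

/-- The derivative of `prof`. -/
noncomputable def profD (L : ℝ) : ℝ := 1 - 2 / L + (10 - 4 * log L + 4 * log 2) / L ^ 2

/-- The second derivative of `prof`. -/
noncomputable def profDD (L : ℝ) : ℝ := 2 / L ^ 2 + (8 * log L - 8 * log 2 - 24) / L ^ 3

/-- The second derivative of `log ∘ prof`. -/
noncomputable def logProfDD (L : ℝ) : ℝ := (profDD L * prof L - profD L ^ 2) / prof L ^ 2

variable {L : ℝ}

theorem hasDerivAt_prof (hL : 0 < L) : HasDerivAt prof (profD L) L := by
  have hl := hasDerivAt_log hL.ne'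
  have h1 := (((hl.const_mul 4).sub_const (4 * log 2)).sub_const 6).div (hasDerivAt_id L) hL.ne'
  refine ((((hasDerivAt_id L).sub (hl.const_mul 2)).add_const (2 * log 2)).add h1).congr_deriv ?_
  simp only [id, profD]
  field_simp
  ring

theorem hasDerivAt_profD (hL : 0 < L) : HasDerivAt profD (profDD L) L := by
  have hl := hasDerivAt_log hL.ne'
  have h1 := (((hl.const_mul 4).const_sub 10).add_const (4 * log 2)).div (hasDerivAt_pow 2 L)
    (pow_ne_zero 2 hL.ne')
  have h2 := (hasDerivAt_const L (2 : ℝ)).div (hasDerivAt_id L) hL.ne'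
  refine ((h2.const_sub 1).add h1).congr_deriv ?_
  simp only [id, profDD]
  field_simp
  ring

theorem hasDerivAt_log_prof (hL : 0 < L) (hp : 0 < prof L) :
    HasDerivAt (fun y => log (prof y)) (profD L / prof L) L :=
  (hasDerivAt_prof hL).log hp.ne'

theorem hasDerivAt_logProfD (hL : 0 < L) (hp : 0 < prof L) :
    HasDerivAt (fun y => profD y / prof y) (logProfDD L) L := by
  refine ((hasDerivAt_profD hL).div (hasDerivAt_prof hL) hp.ne').congr_deriv ?_
  rw [logProfDD, sq (profD L)]

/-- The terms `-2 log L + 2 log 2` are what makes the nonlinearity match `-(log L)'' = 1 / L ^ 2` to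
leading order. -/
theorem exp_prof (hL : 0 < L) : 1 / 4 * exp (-L + prof L) = exp (profCorr L) / L ^ 2 := by
  have e : -L + prof L = profCorr L + (log 2 + log 2) - (log L + log L) := by rw [prof]; ring
  rw [e, exp_sub, exp_add (profCorr L), exp_add (log 2), exp_add (log L), exp_log two_pos,
    exp_log hL]
  ring

/-- The relative deviation of `prof L` from `L`. -/
noncomputable def profRel (L : ℝ) : ℝ := (-2 * log L + 2 * log 2 + profCorr L) / L

theorem prof_eq (hL : L ≠ 0) : prof L = L * (1 + profRel L) := by
  rw [prof, profRel]; field_simp; ring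

theorem isBigO_const_add_mul_log_div (c d : ℝ) :
    (fun L : ℝ => (c * log L + d) / L) =O[atTop] fun L => log L / L := by
  have h1 : (fun L : ℝ => d / L) =O[atTop] fun L => log L / L := by
    simpa using isBigO_inv_log_div d
  have h2 := ((isBigO_refl (fun L : ℝ => log L / L) atTop).const_mul_left c).add h1
  exact h2.congr_left fun L => by ring

theorem isBigO_profCorr : profCorr =O[atTop] fun L => log L / L :=
  (isBigO_const_add_mul_log_div 4 (-4 * log 2 - 6)).congr_left fun L => by rw [profCorr]; ring

theorem isBigO_log_div_one : (fun L : ℝ => log L / L) =O[atTop] fun _ => (1 : ℝ) :=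
  tendsto_log_div_self.isBigO_one ℝ

theorem isBigO_inv_log_div' : (fun L : ℝ => 1 / L) =O[atTop] fun L => log L / L := by
  simpa using isBigO_inv_log_div 1

theorem isBigO_profRel : profRel =O[atTop] fun L => log L / L := by
  have h1 := isBigO_profCorr.mul (isBigO_inv_log_div'.trans isBigO_log_div_one)
  simp only [mul_one] at h1
  refine ((isBigO_const_add_mul_log_div (-2) (2 * log 2)).add h1).congr_left fun L => ?_
  rw [profRel]; ring

theorem tendsto_profCorr : Tendsto profCorr atTop (𝓝 0) :=
  isBigO_profCorr.trans_tendsto tendsto_log_div_self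

theorem tendsto_profRel : Tendsto profRel atTop (𝓝 0) :=
  isBigO_profRel.trans_tendsto tendsto_log_div_self

theorem isBigO_exp_profCorr :
    (fun L => exp (profCorr L) - 1 - profCorr L) =O[atTop] fun L => log L / L * (log L / L) := by
  refine IsBigO.trans ?_ (isBigO_profCorr.mul isBigO_profCorr)
  refine IsBigO.of_bound 1 ?_
  filter_upwards [tendsto_profCorr.eventually (Icc_mem_nhds (show (-1 : ℝ) < 0 by norm_num)
    one_pos)] with L hL
  rw [one_mul, norm_eq_abs, norm_of_nonneg (mul_self_nonneg _), ← sq]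
  exact abs_exp_sub_one_sub_id_le (abs_le.2 hL)

/-- This is the residual of `log ∘ prof` multiplied by `prof ^ 2`. The coefficients of `profCorr`
are chosen so that all first-order terms cancel. -/
theorem isBigO_residual_mul :
    (fun L => (1 + profRel L) ^ 2 * exp (profCorr L) -
        (profD L ^ 2 - (1 + profRel L) * (L * profDD L)))
      =O[atTop] fun L => log L / L * (log L / L) := by
  have hx := isBigO_inv_log_div'
  have ha := isBigO_profCorr
  have hb := isBigO_profRel
  have h1 := isBigO_log_div_one
  have lift1 : ∀ {f g : ℝ → ℝ}, f =O[atTop] (fun L => log L / L * (log L / L)) →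
      g =O[atTop] (fun _ => (1 : ℝ)) →
      (fun L => f L * g L) =O[atTop] fun L => log L / L * (log L / L) := by
    intro f g hf hg
    simpa using hf.mul hg
  have hc : (fun L : ℝ => (10 - 4 * log L + 4 * log 2) / L ^ 2) =O[atTop]
      fun L => log L / L * (log L / L) :=
    ((isBigO_const_add_mul_log_div (-4) (10 + 4 * log 2)).mul hx).congr_left fun L => by
      rw [div_mul_div_comm]; ring
  have hd : (fun L : ℝ => (8 * log L - 8 * log 2 - 24) / L ^ 2) =O[atTop]
      fun L => log L / L * (log L / L) :=
    ((isBigO_const_add_mul_log_div 8 (-8 * log 2 - 24)).mul hx).congr_left fun L => by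
      rw [div_mul_div_comm]; ring
  have hb1 : (fun L => (1 + profRel L) ^ 2) =O[atTop] fun _ => (1 : ℝ) := by
    have : Tendsto (fun L => (1 + profRel L) ^ 2) atTop (𝓝 ((1 + 0) ^ 2)) :=
      (tendsto_profRel.const_add 1).pow 2
    exact this.isBigO_one ℝ
  have hc1 := hc.trans (g := fun L : ℝ => log L / L * (log L / L)) (k := fun _ => (1 : ℝ))
    (by simpa only [mul_one] using h1.mul h1)
  have hab := lift1 (ha.mul hb) (hb.trans h1)
  have hcx := lift1 hc (hx.trans h1)
  have hcc := lift1 hc hc1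
  have hdb := lift1 hd (hb.trans h1)
  have hexp := lift1 isBigO_exp_profCorr hb1
  have hsum := (((hx.mul ha).const_mul_left 2).add (hb.mul hb)).add
    ((ha.mul hb).const_mul_left 2)
  replace hsum := ((hsum.add hab).sub ((hx.mul hx).const_mul_left 4)).sub (hc.const_mul_left 2)
  replace hsum := ((hsum.add (hcx.const_mul_left 4)).sub hcc).add hd
  replace hsum := ((hsum.add ((hb.mul hx).const_mul_left 2)).add hdb).add hexp
  refine hsum.congr' ?_ EventuallyEq.rfl
  filter_upwards [eventually_gt_atTop 0] with L hL
  -- The sum of all first-order terms: `2 profRel + profCorr` from the nonlinearity, `6 / L` from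
  -- `profD ^ 2` and `L * profDD`.
  have key : 2 * profRel L + profCorr L + 6 * (1 / L) = 2 * (1 / L * profCorr L) := by
    have : profCorr L = (4 * log L - 4 * log 2 - 6) * (1 / L) := by rw [profCorr]; ring
    rw [profRel]
    linear_combination this
  have e1 : L * profDD L = 2 * (1 / L) + (8 * log L - 8 * log 2 - 24) / L ^ 2 := by
    rw [profDD]; field_simp
  have e2 : profD L = 1 - 2 * (1 / L) + (10 - 4 * log L + 4 * log 2) / L ^ 2 := by
    rw [profD]; ring
  rw [e1, e2]
  generalize (10 - 4 * log L + 4 * log 2) / L ^ 2 = c at *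
  generalize (8 * log L - 8 * log 2 - 24) / L ^ 2 = d at *
  linear_combination (-1 : ℝ) * key

/-- The residual is of size `L⁻² (log L / L) ^ 2`; this limit makes it `o(L ^ (-7/2))`. -/
theorem tendsto_log_div_sq_mul :
    Tendsto (fun L : ℝ => L ^ (3 / 2 : ℝ) * (log L / L * (log L / L))) atTop (𝓝 0) := by
  have h := (isLittleO_log_rpow_atTop (r := 1 / 4) (by norm_num)).tendsto_div_nhds_zero
  have h2 := h.mul h
  rw [mul_zero] at h2
  refine h2.congr' ?_
  filter_upwards [eventually_gt_atTop 0] with L hL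
  have e1 : L ^ (3 / 2 : ℝ) * (L ^ (1 / 4 : ℝ) * L ^ (1 / 4 : ℝ)) = L * L := by
    rw [← rpow_add hL, ← rpow_add hL, ← sq, ← rpow_natCast]; norm_num
  have h3 := rpow_pos_of_pos hL (1 / 4)
  rw [div_mul_div_comm, div_mul_div_comm, ← e1]
  have h4 := rpow_pos_of_pos hL (3 / 2)
  field_simp

/-- `log ∘ prof` solves the profile equation up to a small error. -/
theorem eventually_residual_le :
    ∀ᶠ L in atTop, |1 / 4 * exp (-L + prof L) + logProfDD L| ≤ 1 / 4 * L ^ (-7 / 2 : ℝ) := by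
  have hinv : (fun L => ((1 + profRel L) ^ 2)⁻¹) =O[atTop] fun _ => (1 : ℝ) := by
    have : Tendsto (fun L => ((1 + profRel L) ^ 2)⁻¹) atTop (𝓝 ((1 + 0) ^ 2)⁻¹) :=
      ((tendsto_profRel.const_add 1).pow 2).inv₀ (by norm_num)
    exact this.isBigO_one ℝ
  have h1 := (isBigO_residual_mul.mul hinv)
  simp only [mul_one] at h1
  have h2 := ((isBigO_refl (fun L : ℝ => L ^ (3 / 2 : ℝ)) atTop).mul h1).trans_tendsto
    tendsto_log_div_sq_mul
  filter_upwards [h2.eventually (Icc_mem_nhds (show (-(1 / 4) : ℝ) < 0 by norm_num)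
    (show (0 : ℝ) < 1 / 4 by norm_num)), eventually_gt_atTop 0,
    tendsto_profRel.eventually (lt_mem_nhds (show (-1 : ℝ) < 0 by norm_num))] with L h hL hb
  have hb1 : 0 < 1 + profRel L := by linarith
  have e : 1 / 4 * exp (-L + prof L) + logProfDD L =
      (L ^ 2)⁻¹ * (((1 + profRel L) ^ 2 * exp (profCorr L) -
        (profD L ^ 2 - (1 + profRel L) * (L * profDD L))) * ((1 + profRel L) ^ 2)⁻¹) := by
    rw [exp_prof hL, logProfDD, prof_eq hL.ne']
    field_simp
    ring
  rw [e]
  generalize ((1 + profRel L) ^ 2 * exp (profCorr L) -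
        (profD L ^ 2 - (1 + profRel L) * (L * profDD L))) * ((1 + profRel L) ^ 2)⁻¹ = X at h ⊢
  have h3 := abs_le.2 h
  have hr := rpow_pos_of_pos hL (3 / 2)
  rw [abs_mul, abs_of_pos hr] at h3
  have e7 : L ^ (-7 / 2 : ℝ) = (L ^ (3 / 2 : ℝ))⁻¹ * (L ^ 2)⁻¹ := by
    rw [← rpow_neg hL.le, ← rpow_natCast, ← rpow_neg hL.le, ← rpow_add hL]; norm_num
  rw [abs_mul, abs_of_pos (by positivity), e7]
  calc (L ^ 2)⁻¹ * |X| = (L ^ 2)⁻¹ * ((L ^ (3 / 2 : ℝ))⁻¹ * (L ^ (3 / 2 : ℝ) * |X|)) := by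
        field_simp
    _ ≤ (L ^ 2)⁻¹ * ((L ^ (3 / 2 : ℝ))⁻¹ * (1 / 4)) := by gcongr
    _ = _ := by ring

/-- The linearization of the profile equation at a point close to `log ∘ prof` is close to the
oscillator. -/
theorem eventually_linearization_le :
    ∀ᶠ L in atTop, ∀ θ : ℝ, |θ| ≤ 1 / L ^ 2 →
      |1 / L + 3 / (16 * L ^ 2) - 1 / 4 * exp (-L + prof L * exp θ) * (prof L * exp θ)| ≤
        1 / 2 * L ^ (-3 / 2 : ℝ) := by
  have hs := tendsto_sqrt_mul_log_div
  have ha := tendsto_sqrt_mul_of_isBigO isBigO_profCorr hs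
  have hb := tendsto_sqrt_mul_of_isBigO isBigO_profRel hs
  have hx := tendsto_sqrt_mul_of_isBigO isBigO_inv_log_div' hs
  -- Any small margin works: below, the exponent `ε` costs `1 + 4 + 1` hundredths of `v = (√L)⁻¹`,
  -- and the total stays under `v / 2`.
  have hnb : Icc (-(1 / 100) : ℝ) (1 / 100) ∈ 𝓝 (0 : ℝ) :=
    Icc_mem_nhds (by norm_num) (by norm_num)
  filter_upwards [ha.eventually hnb, hb.eventually hnb, hx.eventually hnb,
    eventually_ge_atTop 1] with L ha hb hx hL θ hθ
  have hL0 : 0 < L := by linarith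
  have hw : 1 ≤ √L := one_le_sqrt.2 hL
  have hw0 : 0 < √L := by linarith
  have conv : ∀ {X : ℝ}, √L * X ∈ Icc (-(1 / 100) : ℝ) (1 / 100) → |X| ≤ 1 / 100 * (√L)⁻¹ := by
    intro X hX
    have := abs_le.2 hX
    rw [abs_mul, abs_of_pos hw0] at this
    rw [← div_eq_mul_inv, le_div_iff₀ hw0]; linarith
  have hv1 : (√L)⁻¹ ≤ 1 := inv_le_one_of_one_le₀ hw
  have hv0 : 0 < (√L)⁻¹ := inv_pos.2 hw0
  replace ha := conv ha
  replace hb := conv hb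
  replace hx := conv hx
  rw [abs_of_pos (by positivity)] at hx
  have e3 : L ^ (-3 / 2 : ℝ) = 1 / L * (√L)⁻¹ := by
    rw [sqrt_eq_rpow, ← rpow_neg hL0.le, one_div, ← rpow_neg_one, ← rpow_add hL0]; norm_num
  rw [e3]
  generalize (√L)⁻¹ = v at *
  have hxx : 1 / L ^ 2 = 1 / L * (1 / L) := by field_simp
  have hx0 : 0 < 1 / L := by positivity
  have hθ1 : |θ| ≤ 1 / L * (1 / L) := hxx ▸ hθ
  have hθ2 : |θ| ≤ 1 / L := hθ1.trans (by nlinarith)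
  have hθ3 : |θ| ≤ 1 := by nlinarith
  have hex : |exp θ - 1| ≤ 2 * |θ| := abs_exp_sub_one_le hθ3
  set b := profRel L with hbdef
  have hp : prof L = L * (1 + b) := prof_eq hL0.ne'
  set ε := profCorr L + prof L * (exp θ - 1) + θ with hε
  have hb2 : |1 + b| ≤ 2 := by
    rw [abs_le] at hb ⊢; constructor <;> linarith [hb.1, hb.2]
  have hp1 : |prof L * (exp θ - 1)| ≤ 4 * (1 / L) := by
    rw [hp, abs_mul, abs_mul, abs_of_pos hL0]
    calc L * |1 + b| * |exp θ - 1| ≤ L * 2 * (2 * (1 / L * (1 / L))) := by gcongr; linarith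
      _ = _ := by field_simp; norm_num
  have hε1 : |ε| ≤ 6 / 100 * v := by
    have := abs_add_three (profCorr L) (prof L * (exp θ - 1)) θ
    linarith
  have hε2 : |exp ε - 1| ≤ 12 / 100 * v := by
    have := abs_exp_sub_one_le (x := ε) (by linarith)
    linarith
  have e : 1 / 4 * exp (-L + prof L * exp θ) * (prof L * exp θ) = 1 / L * ((1 + b) * exp ε) := by
    have e4 : -L + prof L * exp θ = (-L + prof L) + prof L * (exp θ - 1) := by ring
    rw [e4, exp_add, ← mul_assoc (1 / 4 : ℝ), exp_prof hL0, hε, exp_add, exp_add, hp]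
    field_simp
  have e5 : 1 / L + 3 / (16 * L ^ 2) - 1 / L * ((1 + b) * exp ε) =
      1 / L * (3 / 16 * (1 / L) + -((1 + b) * (exp ε - 1)) + -b) := by
    field_simp; ring
  rw [e, e5, abs_mul, abs_of_pos hx0]
  have k1 : |(1 + b) * (exp ε - 1)| ≤ 2 * (12 / 100 * v) := by
    rw [abs_mul]; gcongr
  have k2 := abs_add_three (3 / 16 * (1 / L)) (-((1 + b) * (exp ε - 1))) (-b)
  rw [abs_neg, abs_neg, abs_of_pos (show 0 < 3 / 16 * (1 / L) by positivity)] at k2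
  have k3 : |3 / 16 * (1 / L) + -((1 + b) * (exp ε - 1)) + -b| ≤ 1 / 2 * v := by linarith
  calc _ ≤ 1 / L * (1 / 2 * v) := by gcongr
    _ = _ := by ring

end Profile

/-! ### Solving for the correction and assembling the profile. -/

section Existence

/-- Truncation to `[-1, 1]`. -/
noncomputable def clip (c : ℝ) : ℝ := max (-1) (min 1 c)

theorem continuous_clip : Continuous clip := by unfold clip; fun_prop

theorem abs_clip_le (c : ℝ) : |clip c| ≤ 1 :=
  abs_le.2 ⟨le_max_left _ _, max_le (by norm_num) (min_le_left _ _)⟩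

theorem clip_of_abs_le {c : ℝ} (hc : |c| ≤ 1) : clip c = c := by
  rw [abs_le] at hc
  rw [clip, min_eq_right hc.2, max_eq_right hc.1]

theorem abs_clip_sub_clip_le (c d : ℝ) : |clip c - clip d| ≤ |c - d| := by
  simp only [clip]
  grind

/-- With `exp y = prof * exp θ`, the profile equation becomes the oscillator with forcing `N`: small
at `θ = 0` by the residual bound, weakly Lipschitz by the linearization bound. -/
theorem exists_profile_correction :
    ∃ (L₀ : ℝ) (θ θ' : ℝ → ℝ), ∀ L, L₀ < L → 0 < L ∧ 0 < prof L ∧ |L ^ 2 * θ L| ≤ 1 ∧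
      HasDerivAt θ (θ' L) L ∧
      HasDerivAt θ' (-(1 / 4 * exp (-L + prof L * exp (θ L))) - logProfDD L) L := by
  have hev := (eventually_residual_le.and eventually_linearization_le).and
    (tendsto_profRel.eventually (lt_mem_nhds (show (-1 : ℝ) < 0 by norm_num)))
  obtain ⟨a₁, ha₁⟩ := eventually_atTop.1 hev
  set a := max a₁ 0
  have ha : 0 ≤ a := le_max_right _ _
  have hpos : ∀ L, a < L → 0 < L := fun L hL => lt_of_le_of_lt ha hL
  have hprof : ∀ L, a < L → 0 < prof L := by
    intro L hL
    have := (ha₁ L ((le_max_left _ _).trans hL.le)).2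
    rw [prof_eq (hpos L hL).ne']
    exact mul_pos (hpos L hL) (by linarith)
  let N : ℝ → ℝ → ℝ := fun L θ =>
    (1 / L + 3 / (16 * L ^ 2)) * θ - 1 / 4 * exp (-L + prof L * exp θ) - logProfDD L
  -- Truncation makes the Lipschitz bound global; it is invisible on the solution, which satisfies
  -- `|L ^ 2 θ| ≤ 1`.
  let M : ℝ → ℝ → ℝ := fun L c => N L (clip c / L ^ 2)
  have hM : ContinuousOn (Function.uncurry M) (Ioi a ×ˢ univ) := by
    have hfst : MapsTo Prod.fst (Ioi a ×ˢ (univ : Set ℝ)) (Ioi a) := fun z hz => hz.1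
    have c1 : ContinuousOn (fun z : ℝ × ℝ => prof z.1) (Ioi a ×ˢ univ) :=
      ContinuousOn.comp (t := Ioi a) (g := prof)
        (fun L hL => (hasDerivAt_prof (hpos L hL)).continuousAt.continuousWithinAt)
        continuousOn_fst hfst
    have c2 : ContinuousOn (fun z : ℝ × ℝ => profD z.1) (Ioi a ×ˢ univ) :=
      ContinuousOn.comp (t := Ioi a) (g := profD)
        (fun L hL => (hasDerivAt_profD (hpos L hL)).continuousAt.continuousWithinAt)
        continuousOn_fst hfst
    have hz : ∀ z ∈ Ioi a ×ˢ (univ : Set ℝ), z.1 ≠ 0 := fun z hz => (hpos _ hz.1).ne'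
    have hlog : ContinuousOn (fun z : ℝ × ℝ => log z.1) (Ioi a ×ˢ univ) :=
      continuousOn_fst.log hz
    have c3 : ContinuousOn (fun z : ℝ × ℝ => profDD z.1) (Ioi a ×ˢ univ) := by
      unfold profDD
      refine (continuousOn_const.div (continuousOn_fst.pow 2) fun z h => pow_ne_zero 2 (hz z h)).add
        (ContinuousOn.div ?_ (continuousOn_fst.pow 3) fun z h => pow_ne_zero 3 (hz z h))
      fun_prop
    have c4 : ContinuousOn (fun z : ℝ × ℝ => logProfDD z.1) (Ioi a ×ˢ univ) := by
      unfold logProfDD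
      exact ((c3.mul c1).sub (c2.pow 2)).div (c1.pow 2)
        fun z h => pow_ne_zero 2 (hprof _ h.1).ne'
    have c5 : ContinuousOn (fun z : ℝ × ℝ => clip z.2 / z.1 ^ 2) (Ioi a ×ˢ univ) :=
      (continuous_clip.comp continuous_snd).continuousOn.div (continuousOn_fst.pow 2)
        fun z h => pow_ne_zero 2 (hz z h)
    have c6 : ContinuousOn (fun z : ℝ × ℝ => 1 / z.1 + 3 / (16 * z.1 ^ 2)) (Ioi a ×ˢ univ) :=
      (continuousOn_const.div continuousOn_fst hz).add (continuousOn_const.div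
        (continuousOn_const.mul (continuousOn_fst.pow 2))
        fun z h => mul_ne_zero (by norm_num) (pow_ne_zero 2 (hz z h)))
    exact ((c6.mul c5).sub (continuousOn_const.mul
      (continuousOn_fst.neg.add (c1.mul c5.rexp)).rexp)).sub c4
  have h0 : ∀ s, a < s → |M s 0| ≤ 1 / 4 * s ^ (-7 / 2 : ℝ) := by
    intro s hs
    have h1 := (ha₁ s ((le_max_left _ _).trans hs.le)).1.1
    have e : M s 0 = -(1 / 4 * exp (-s + prof s) + logProfDD s) := by
      simp only [M, N, clip_of_abs_le (show |(0 : ℝ)| ≤ 1 by simp), zero_div, mul_zero, exp_zero,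
        mul_one]
      ring
    rw [e, abs_neg]
    exact h1
  have hlip : ∀ s, a < s → ∀ c d, |M s c - M s d| ≤ 1 / 2 * |c - d| * s ^ (-7 / 2 : ℝ) := by
    intro s hs c d
    have hs0 := hpos s hs
    have h1 := (ha₁ s ((le_max_left _ _).trans hs.le)).1.2
    have hder : ∀ θ, HasDerivAt (N s) (1 / s + 3 / (16 * s ^ 2) -
        1 / 4 * exp (-s + prof s * exp θ) * (prof s * exp θ)) θ := by
      intro θ
      refine ((((hasDerivAt_id θ).const_mul (1 / s + 3 / (16 * s ^ 2))).sub
        ((((hasDerivAt_exp θ).const_mul (prof s)).const_add (-s)).exp.const_mul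
          (1 / 4))).sub_const (logProfDD s)).congr_deriv ?_
      ring
    have hmem : ∀ c, clip c / s ^ 2 ∈ Icc (-(1 / s ^ 2)) (1 / s ^ 2) := by
      intro c
      rw [mem_Icc, ← abs_le, abs_div, abs_of_pos (pow_pos hs0 2)]
      gcongr
      exact abs_clip_le c
    have h2 := (convex_Icc (-(1 / s ^ 2)) (1 / s ^ 2)).norm_image_sub_le_of_norm_hasDerivWithin_le
      (fun θ _ => (hder θ).hasDerivWithinAt) (fun θ hθ => h1 θ (abs_le.2 hθ)) (hmem d) (hmem c)
    have e1 : |clip c / s ^ 2 - clip d / s ^ 2| ≤ |c - d| * (s ^ 2)⁻¹ := by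
      rw [← sub_div, abs_div, abs_of_pos (pow_pos hs0 2), div_eq_mul_inv]
      exact mul_le_mul_of_nonneg_right (abs_clip_sub_clip_le c d) (by positivity)
    -- `s ^ (-3/2)` comes from the linearization, `s⁻²` from the rescaling `θ = c / s ^ 2`.
    have e2 : s ^ (-7 / 2 : ℝ) = s ^ (-3 / 2 : ℝ) * (s ^ 2)⁻¹ := by
      rw [← rpow_natCast, ← rpow_neg hs0.le, ← rpow_add hs0]; norm_num
    have hr := rpow_pos_of_pos hs0 (-3 / 2)
    calc |M s c - M s d| ≤ 1 / 2 * s ^ (-3 / 2 : ℝ) * |clip c / s ^ 2 - clip d / s ^ 2| := h2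
      _ ≤ 1 / 2 * s ^ (-3 / 2 : ℝ) * (|c - d| * (s ^ 2)⁻¹) := by gcongr
      _ = _ := by rw [e2]; ring
  obtain ⟨θ, θ', hθ⟩ := exists_perturbed_oscillator ha hM h0 hlip
  refine ⟨a + 1, θ, θ', fun L hL => ?_⟩
  have haL : a < L := by linarith
  have hL0 := hpos L haL
  obtain ⟨h1, h2, h3⟩ := hθ L hL
  refine ⟨hL0, hprof L haL, h1, h2, h3.congr_deriv ?_⟩
  simp only [M, N, clip_of_abs_le h1, mul_div_cancel_left₀ (θ L) (pow_pos hL0 2).ne']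
  ring

/-- Solutions of `y'' = -exp (-L + exp y) / 4` are smooth. -/
theorem contDiffOn_of_profile_equation {y y' : ℝ → ℝ} {L₀ : ℝ}
    (hd : ∀ L, L₀ < L → HasDerivAt y (y' L) L)
    (hd' : ∀ L, L₀ < L → HasDerivAt y' (-(1 / 4 * exp (-L + exp (y L)))) L) :
    ContDiffOn ℝ ∞ y (Ioi L₀) := by
  have step : ∀ {n : ℕ} {u v : ℝ → ℝ}, (∀ L, L₀ < L → HasDerivAt u (v L) L) →
      ContDiffOn ℝ n v (Ioi L₀) → ContDiffOn ℝ (n + 1 : ℕ) u (Ioi L₀) := by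
    intro n u v huv hv
    push_cast
    refine (contDiffOn_succ_iff_deriv_of_isOpen isOpen_Ioi).2
      ⟨fun L hL => (huv L hL).differentiableAt.differentiableWithinAt, by simp, ?_⟩
    exact hv.congr fun L hL => (huv L hL).deriv
  have key : ∀ n : ℕ, ContDiffOn ℝ n y (Ioi L₀) ∧ ContDiffOn ℝ n y' (Ioi L₀) := by
    intro n
    induction n with
    | zero =>
      simp only [Nat.cast_zero, contDiffOn_zero]
      exact ⟨fun L hL => (hd L hL).continuousAt.continuousWithinAt,
        fun L hL => (hd' L hL).continuousAt.continuousWithinAt⟩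
    | succ n ih =>
      refine ⟨step hd ih.2, step hd' ?_⟩
      exact (contDiffOn_const.mul ((contDiffOn_id.neg.add ih.1.exp).exp)).neg
  exact contDiffOn_infty.2 fun n => (key n).1

theorem tendsto_prof : Tendsto prof atTop atTop := by
  have h := tendsto_id.atTop_mul_pos (show (0 : ℝ) < 1 + 0 by norm_num)
    (tendsto_profRel.const_add 1)
  refine h.congr' ?_
  filter_upwards [eventually_gt_atTop 0] with L hL
  rw [id, prof_eq hL.ne']

theorem exists_profile : ∃ (L₀ : ℝ) (y y' : ℝ → ℝ), ContDiffOn ℝ ∞ y (Ioi L₀) ∧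
    (∀ L, L₀ < L → 0 ≤ y L) ∧ (∀ L, L₀ < L → HasDerivAt y (y' L) L) ∧
    (∀ L, L₀ < L → HasDerivAt y' (-(1 / 4 * exp (-L + exp (y L)))) L) ∧
    Tendsto y atTop atTop ∧
    (fun L => y L - log (prof L)) =O[atTop] fun L => log L / L * (1 / L) := by
  obtain ⟨L₁, θ, θ', h⟩ := exists_profile_correction
  have hO : θ =O[atTop] fun L => log L / L * (1 / L) := by
    refine IsBigO.of_bound 1 ?_
    filter_upwards [eventually_gt_atTop L₁, eventually_ge_atTop (exp 1)] with L hL he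
    obtain ⟨hL0, -, h1, -, -⟩ := h L hL
    have hl : 1 ≤ log L := (le_log_iff_exp_le hL0).2 he
    rw [abs_mul, abs_of_pos (pow_pos hL0 2)] at h1
    rw [norm_eq_abs, norm_of_nonneg (by positivity), one_mul, div_mul_div_comm,
      le_div_iff₀ (by positivity)]
    linarith [show |θ L| * (L * L) = L ^ 2 * |θ L| by ring]
  have hlim0 : Tendsto (fun L : ℝ => log L / L * (1 / L)) atTop (𝓝 0) := by
    simpa using tendsto_log_div_self.mul tendsto_inv_atTop_zero
  have hθ0 : Tendsto θ atTop (𝓝 0) := hO.trans_tendsto hlim0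
  have hlim : Tendsto (fun L => log (prof L) + θ L) atTop atTop :=
    (tendsto_log_atTop.comp tendsto_prof).atTop_add hθ0
  -- Shrinking the disc secures nonnegativity.
  obtain ⟨L₂, hL₂⟩ := eventually_atTop.1 (hlim.eventually_ge_atTop 0)
  have hd : ∀ L, max L₁ L₂ < L → HasDerivAt (fun L => log (prof L) + θ L)
      (profD L / prof L + θ' L) L := by
    intro L hL
    obtain ⟨hL0, hp, -, h2, -⟩ := h L ((le_max_left _ _).trans_lt hL)
    exact (hasDerivAt_log_prof hL0 hp).add h2
  have hd' : ∀ L, max L₁ L₂ < L → HasDerivAt (fun L => profD L / prof L + θ' L)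
      (-(1 / 4 * exp (-L + exp (log (prof L) + θ L)))) L := by
    intro L hL
    obtain ⟨hL0, hp, -, -, h3⟩ := h L ((le_max_left _ _).trans_lt hL)
    refine ((hasDerivAt_logProfD hL0 hp).add h3).congr_deriv ?_
    rw [exp_add (log (prof L)), exp_log hp]
    ring
  refine ⟨max L₁ L₂, _, _, contDiffOn_of_profile_equation hd hd',
    fun L hL => hL₂ L ((le_max_right _ _).trans hL.le), hd, hd', hlim, ?_⟩
  simpa using hO

end Existence

/-! ### Comparison with the asymptotic formula in `w`. -/

section Expansion

theorem isBigO_log_of_tendsto_one {X e : ℝ → ℝ} (hX : Tendsto X atTop (𝓝 1))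
    (h : (fun L => X L - 1) =O[atTop] e) : (fun L => log (X L)) =O[atTop] e := by
  have h1 := (hasDerivAt_log one_ne_zero).isBigO_sub.comp_tendsto hX
  simp only [Function.comp_def, log_one, sub_zero] at h1
  exact h1.trans h

theorem tendsto_neg_log_modelTail_div :
    Tendsto (fun L => -log (modelTail L) / L) atTop (𝓝 1) := by
  simpa using (isBigO_neg_log_modelTail.trans_tendsto tendsto_log_div_self).add_const 1

theorem isBigO_log_neg_log_modelTail :
    (fun L => log (-log (modelTail L)) - log L) =O[atTop] fun L => log L / L := by
  have h := isBigO_log_of_tendsto_one tendsto_neg_log_modelTail_div isBigO_neg_log_modelTail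
  refine h.congr' ?_ EventuallyEq.rfl
  filter_upwards [eventually_gt_atTop 0,
    tendsto_neg_log_modelTail_div.eventually (lt_mem_nhds one_pos)] with L hL h1
  exact log_div (fun h => by rw [h, zero_div] at h1; exact lt_irrefl _ h1) hL.ne'

/-- The relative deviation from `L` of `-log w - log (-log w)`. -/
noncomputable def targetRel (L : ℝ) : ℝ :=
  (-log (modelTail L) - log (-log (modelTail L))) / L - 1

theorem isBigO_log_one_add_inv :
    (fun L : ℝ => log (L + 1) - log L) =O[atTop] fun L => log L / L := by
  have h1 : Tendsto (fun L : ℝ => 1 + 1 / L) atTop (𝓝 1) := by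
    simpa using tendsto_inv_atTop_zero.const_add (1 : ℝ)
  refine (isBigO_log_of_tendsto_one h1 (isBigO_inv_log_div 1)).congr' ?_ EventuallyEq.rfl
  filter_upwards [eventually_gt_atTop 0] with L hL
  rw [← log_div (by linarith) hL.ne']
  congr 1
  field_simp

/-- Since `-log w = L - log (L + 1) + 2 log 2` and `log (-log w) = log L + O(log L / L)`, the target
agrees with `L - 2 log L + 2 log 2`, hence with `prof`, up to `O(log L / L)`. -/
theorem isBigO_profRel_sub_targetRel :
    (fun L => profRel L - targetRel L) =O[atTop] fun L => log L / L * (1 / L) := by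
  have h := ((isBigO_log_one_add_inv.add isBigO_log_neg_log_modelTail).add isBigO_profCorr).mul
    (isBigO_refl (fun L : ℝ => 1 / L) atTop)
  refine h.congr' ?_ EventuallyEq.rfl
  filter_upwards [eventually_gt_atTop 0] with L hL
  have h4 : log 4 = 2 * log 2 := by
    rw [show (4 : ℝ) = 2 ^ 2 by norm_num, log_pow]; norm_num
  rw [targetRel, profRel]
  generalize hA : log (-log (modelTail L)) = A
  rw [neg_log_modelTail hL, h4]
  field_simp
  ring

theorem tendsto_targetRel : Tendsto targetRel atTop (𝓝 0) := by
  have hlim0 : Tendsto (fun L : ℝ => log L / L * (1 / L)) atTop (𝓝 0) := by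
    simpa using tendsto_log_div_self.mul tendsto_inv_atTop_zero
  simpa using tendsto_profRel.sub (isBigO_profRel_sub_targetRel.trans_tendsto hlim0)

theorem isBigO_log_prof_sub_target :
    (fun L => log (prof L) - log (-log (modelTail L) - log (-log (modelTail L)))) =O[atTop]
      fun L => log L / L * (1 / L) := by
  have ht : Tendsto (fun L => 1 + targetRel L) atTop (𝓝 1) := by
    simpa using tendsto_targetRel.const_add 1
  have hp : Tendsto (fun L => 1 + profRel L) atTop (𝓝 1) := by
    simpa using tendsto_profRel.const_add 1
  have hq : Tendsto (fun L => (1 + profRel L) / (1 + targetRel L)) atTop (𝓝 1) := by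
    have := hp.div ht one_ne_zero
    rwa [div_one] at this
  have hinv : (fun L => (1 + targetRel L)⁻¹) =O[atTop] fun _ => (1 : ℝ) :=
    (ht.inv₀ one_ne_zero).isBigO_one ℝ
  have h1 := isBigO_profRel_sub_targetRel.mul hinv
  simp only [mul_one] at h1
  have hev := (ht.eventually (lt_mem_nhds one_pos)).and
    ((hp.eventually (lt_mem_nhds one_pos)).and (eventually_gt_atTop 0))
  have h2 : (fun L => (1 + profRel L) / (1 + targetRel L) - 1) =O[atTop]
      fun L => log L / L * (1 / L) := by
    refine h1.congr' ?_ EventuallyEq.rfl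
    filter_upwards [hev] with L hL
    have := hL.1.ne'
    field_simp
    ring
  refine (isBigO_log_of_tendsto_one hq h2).congr' ?_ EventuallyEq.rfl
  filter_upwards [hev] with L ⟨h3, h4, hL⟩
  have e : -log (modelTail L) - log (-log (modelTail L)) = L * (1 + targetRel L) := by
    rw [targetRel]; field_simp; ring
  rw [e, prof_eq hL.ne', log_mul hL.ne' h4.ne', log_mul hL.ne' h3.ne', log_div h4.ne' h3.ne']
  ring

/-- Rewrites the error in terms of `A = -log w ~ L`: eventually `log L ≤ 2 log A` and `A ≤ 2 L`,
whence the constant `8`. -/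
theorem isBigO_log_div_sq :
    (fun L : ℝ => log L / L * (1 / L)) =O[atTop]
      fun L => log (-log (modelTail L)) / (-log (modelTail L)) ^ 2 := by
  have h1 := isBigO_log_neg_log_modelTail.trans_tendsto tendsto_log_div_self
  refine IsBigO.of_bound 8 ?_
  filter_upwards [h1.eventually (lt_mem_nhds (show (-(1 / 2) : ℝ) < 0 by norm_num)),
    tendsto_neg_log_modelTail_div.eventually (Ioo_mem_nhds one_pos (show (1 : ℝ) < 2 by norm_num)),
    eventually_ge_atTop (exp 1)] with L h2 h3 he
  have hL : 0 < L := lt_of_lt_of_le (exp_pos 1) he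
  have hl : 1 ≤ log L := (le_log_iff_exp_le hL).2 he
  generalize -log (modelTail L) = A at *
  obtain ⟨h4, h5⟩ := h3
  have hA : 0 < A := by
    have := mul_pos h4 hL
    rwa [div_mul_cancel₀ _ hL.ne'] at this
  rw [div_lt_iff₀ hL] at h5
  have h6 : 0 < log A := by linarith
  rw [norm_of_nonneg (by positivity), norm_of_nonneg (by positivity)]
  calc log L / L * (1 / L) = log L / L ^ 2 := by field_simp
    _ ≤ (2 * log A) / L ^ 2 := by gcongr; linarith
    _ = 8 * (log A / (2 * L) ^ 2) := by field_simp; norm_num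
    _ ≤ 8 * (log A / A ^ 2) := by gcongr

theorem wFun_eq {x : Plane} (hx : x ≠ 0) : wFun x = modelTail (log (1 / ‖x‖ ^ 2)) := by
  have h0 : 0 < ‖x‖ := norm_pos_iff.2 hx
  rw [wFun, modelTail, exp_neg, exp_log (by positivity)]
  field_simp

theorem exists_singularSolution_doubleExp_one :
    ∃ R : ℝ, 0 < R ∧ ∃ u : Plane → ℝ, IsSmoothSingularSolution (doubleExp 1) R u ∧
      (fun x : Plane => u x - log (-log (wFun x) - log (-log (wFun x)))) =O[𝓝[≠] 0]
        fun x : Plane => log (-log (wFun x)) / (-log (wFun x)) ^ 2 := by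
  obtain ⟨L₀, y, y', hy, hpos, hd, hd', hlim, hO⟩ := exists_profile
  refine ⟨exp (-L₀ / 2), exp_pos _, fun x => y (log (1 / ‖x‖ ^ 2)),
    isSmoothSingularSolution_of_profile hy hpos hd hd' hlim, ?_⟩
  have h := ((hO.add isBigO_log_prof_sub_target).trans isBigO_log_div_sq).comp_tendsto
    tendsto_log_one_div_sq
  refine h.congr' ?_ ?_
  · filter_upwards [self_mem_nhdsWithin] with x hx
    simp only [Function.comp, wFun_eq hx]
    ring
  · filter_upwards [self_mem_nhdsWithin] with x hx
    simp only [Function.comp, wFun_eq hx]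

end Expansion

end SingularSol

theorem mainTheorem5 :
    (∀ q : ℝ, 1 ≤ q → SingularSol.HasGrowthExponent (SingularSol.doubleExp q) 1) ∧
    SingularSol.DiscrepancyCondition (SingularSol.doubleExp 1) 1 ∧
    (∀ q : ℝ, 1 < q → ¬ SingularSol.DiscrepancyCondition (SingularSol.doubleExp q) 1) ∧
    (∃ R : ℝ, 0 < R ∧ ∃ u : SingularSol.Plane → ℝ,
      SingularSol.IsSmoothSingularSolution (SingularSol.doubleExp 1) R u ∧
      (fun x : SingularSol.Plane =>
          u x - log (-log (SingularSol.wFun x) - log (-log (SingularSol.wFun x))))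
        =O[𝓝[≠] 0]
      (fun x : SingularSol.Plane =>
          log (-log (SingularSol.wFun x)) / (-log (SingularSol.wFun x)) ^ 2)) :=
  ⟨fun _ hq => SingularSol.hasGrowthExponent_doubleExp hq,
    SingularSol.discrepancyCondition_doubleExp_one,
    fun _ hq => SingularSol.not_discrepancyCondition_doubleExp hq,
    SingularSol.exists_singularSolution_doubleExp_one⟩
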